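/- A game arena $\mathcal G=(P,V,(V_p)_{p\in P},v_0,E)$ consists of a finite set $P$ of players, a finite set $V$ of vertices partitioned into (possibly empty) sets $V_p$ controlled by the players $p$, an initial vertex $v_0\in V$ and a set $E\subseteq V\times V$ of edges, such that every vertex reachable from $v_0$ has an outgoing edge. A play is an infinite path from $v_0$, and a history is a non-empty finite prefix of a play. A strategy of $p$ maps each history ending in a vertex $v\in V_p$ to a successor of $v$, and a strategy profile $\sigma=(\sigma_p)_{p\in P}$ consists of one strategy for each player and determines a unique play $\mathrm{out}(\sigma)$, its outcome. For $\mathcal F\subseteq 2^V$ the Muller objective $\mathrm{Muller}(\mathcal F)$ is the set of plays $\rho$ such that the set of vertices occurring infinitely often in $\rho$ belongs to $\mathcal F$. An objective profile over Muller objectives is a tuple $\alpha=(O_p)_{p\in P}$ of Muller objectives. A strategy profile $\sigma$ is a Nash equilibrium for $\alpha$ if for all $p\in P$ and all strategies $\tau$ of $p$, $\mathrm{out}(\sigma[p\mapsto\tau])\in O_p$ implies $\mathrm{out}(\sigma)\in O_p$, where $\sigma[p\mapsto\tau]$ is $\sigma$ with the strategy of $p$ replaced by $\tau$. It is an $(\alpha_1,\dots,\alpha_n)$-Nash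 equilibrium if it is a Nash equilibrium for every $\alpha_j$, $1\le j\le n$. Theorem. The following problem is decidable: given (finite descriptions of) a game arena $\mathcal G$ and finitely many objective profiles $\alpha_1,\dots,\alpha_n$ over Muller objectives, where each objective is given by its family $\mathcal F\subseteq 2^V$, does there exist an $(\alpha_1,\dots,\alpha_n)$-Nash equilibrium? -/

import Mathlib

/-- A game arena with player set `P` and vertex set `V`.  The partition `(V_p)_{p ∈ P}` of `V` is
given by the map `owner` (so `V_p = {v | owner v = p}`, possibly empty).  The last field says that
no vertex which can be reached from the initial vertex is a dead end; this is exactly what makes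
the outcome of every strategy profile an (infinite) play. -/
structure GameArena (P V : Type*) where
  owner : V → P
  init : V
  E : V → V → Prop
  exists_succ : ∀ v, Relation.ReflTransGen E init v → ∃ w, E v w

/-- The finite word `ρ 0, ρ 1, …, ρ i`. -/
def initialSegment {V : Type*} (ρ : ℕ → V) (i : ℕ) : List V :=
  (List.range (i + 1)).map ρ

theorem initialSegment_succ {V : Type*} (ρ : ℕ → V) (i : ℕ) :
    initialSegment ρ (i + 1) = initialSegment ρ i ++ [ρ (i + 1)] := by
  unfold initialSegment
  rw [List.range_succ (n := i + 1)]
  simp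

theorem initialSegment_getLast? {V : Type*} (ρ : ℕ → V) (i : ℕ) :
    (initialSegment ρ i).getLast? = some (ρ i) := by
  unfold initialSegment
  rw [List.range_succ]
  simp

namespace GameArena

variable {P V : Type*} (G : GameArena P V)

/-- An infinite word of vertices is a play if it starts in the initial vertex and follows edges. -/
def IsPlay (ρ : ℕ → V) : Prop :=
  ρ 0 = G.init ∧ ∀ i, G.E (ρ i) (ρ (i + 1))

/-- The set of plays. -/
def Play : Type _ := {ρ : ℕ → V // G.IsPlay ρ}

/-- A history is a non-empty finite prefix of a play. -/
def IsHistory (h : List V) : Prop :=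
  ∃ ρ, G.IsPlay ρ ∧ ∃ i, h = initialSegment ρ i

/-- The set `Hist_p` of histories that end in a vertex controlled by `p`. -/
def HistOf (p : P) : Type _ :=
  {h : List V // G.IsHistory h ∧ ∃ v, h.getLast? = some v ∧ G.owner v = p}

/-- The prefix `ρ 0, …, ρ i` of a play, as an element of `Hist_p` for the player `p` who controls
`ρ i`. -/
def prefixHist {ρ : ℕ → V} (hρ : G.IsPlay ρ) (i : ℕ) : G.HistOf (G.owner (ρ i)) :=
  ⟨initialSegment ρ i, ⟨ρ, hρ, i, rfl⟩, ρ i, initialSegment_getLast? ρ i, rfl⟩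

/-- A strategy of `p` maps every history in `Hist_p` to a successor of its last vertex. -/
def Strategy (p : P) : Type _ :=
  {σ : G.HistOf p → V // ∀ (h : G.HistOf p) (v : V), h.1.getLast? = some v → G.E v (σ h)}

/-- A strategy profile: one strategy for each player. -/
def Profile : Type _ := ∀ p : P, G.Strategy p

/-- The profile `σ[p ↦ τ]`. -/
noncomputable def Profile.deviate {G : GameArena P V} (σ : G.Profile) (p : P)
    (τ : G.Strategy p) : G.Profile :=
  open Classical in Function.update σ p τ

/-- `ρ` is generated by the profile `σ`: at every position the player who controls the current
vertex chooses the next one by her strategy. -/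
def Generates (σ : G.Profile) (ρ : G.Play) : Prop :=
  ∀ i, ρ.1 (i + 1) = (σ (G.owner (ρ.1 i))).1 (G.prefixHist ρ.2 i)

theorem exists_continuation (w : V) (hw : Relation.ReflTransGen G.E G.init w) :
    ∃ c : ℕ → V, c 0 = w ∧ ∀ i, G.E (c i) (c (i + 1)) := by
  choose f hf using fun x : {v // Relation.ReflTransGen G.E G.init v} => G.exists_succ x.1 x.2
  let s : ℕ → {v // Relation.ReflTransGen G.E G.init v} := fun n =>
    Nat.rec ⟨w, hw⟩ (fun _ x => ⟨f x, x.2.tail (hf x)⟩) n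
  exact ⟨fun n => (s n).1, rfl, fun i => hf (s i)⟩

theorem IsPlay.reachable {G : GameArena P V} {ρ : ℕ → V} (hρ : G.IsPlay ρ) (i : ℕ) :
    Relation.ReflTransGen G.E G.init (ρ i) := by
  induction i with
  | zero => rw [hρ.1]
  | succ i ih => exact ih.tail (hρ.2 i)

theorem isHistory_init : G.IsHistory [G.init] := by
  obtain ⟨c, h0, hc⟩ := G.exists_continuation G.init .refl
  exact ⟨c, ⟨h0, hc⟩, 0, by simp [initialSegment, h0]⟩

theorem IsHistory.snoc {G : GameArena P V} {h : List V} (hh : G.IsHistory h) {v w : V}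
    (hv : h.getLast? = some v) (hvw : G.E v w) : G.IsHistory (h ++ [w]) := by
  obtain ⟨ρ, hρ, i, rfl⟩ := hh
  rw [initialSegment_getLast?] at hv
  obtain rfl : ρ i = v := by simpa using hv
  obtain ⟨c, h0, hc⟩ := G.exists_continuation w ((hρ.reachable i).tail hvw)
  refine ⟨fun k => if k ≤ i then ρ k else c (k - (i + 1)), ⟨by simp [hρ.1], fun k => ?_⟩,
    i + 1, ?_⟩
  · rcases lt_trichotomy k i with hk | rfl | hk
    · simp [hk.le, Nat.succ_le_of_lt hk, hρ.2 k]
    · simpa [h0] using hvw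
    · have h1 : ¬ k ≤ i := by omega
      have h2 : ¬ k + 1 ≤ i := by omega
      have h3 : k + 1 - (i + 1) = k - (i + 1) + 1 := by omega
      simp only [h1, h2, if_false, h3]
      exact hc _
  · rw [initialSegment_succ]
    have h1 : ¬ i + 1 ≤ i := by omega
    simp only [h1, if_false, Nat.sub_self, h0]
    congr 1
    unfold initialSegment
    refine List.map_congr_left fun k hk => ?_
    have : k ≤ i := by simpa [Nat.lt_succ_iff] using hk
    simp [this]

/-- Every strategy profile generates exactly one play. -/
theorem existsUnique_generates (σ : G.Profile) : ∃! ρ : G.Play, G.Generates σ ρ := by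
  have key : ∀ h : {h // G.IsHistory h}, ∃ h' : {h // G.IsHistory h}, ∃ v,
      ∃ hv : h.1.getLast? = some v,
      h'.1 = h.1 ++ [(σ (G.owner v)).1 ⟨h.1, h.2, v, hv, rfl⟩] := by
    rintro ⟨h, hh⟩
    obtain ⟨v, hv⟩ : ∃ v, h.getLast? = some v := by
      obtain ⟨ρ, _, i, rfl⟩ := hh
      exact ⟨_, initialSegment_getLast? ρ i⟩
    exact ⟨⟨_, hh.snoc hv ((σ (G.owner v)).2 ⟨h, hh, v, hv, rfl⟩ v hv)⟩, v, hv, rfl⟩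
  choose next last hlast hnext using key
  let s : ℕ → {h // G.IsHistory h} := fun n =>
    Nat.rec ⟨[G.init], G.isHistory_init⟩ (fun _ x => next x) n
  have hs : ∀ n, (s (n + 1)).1 = (s n).1 ++ [last (s (n + 1))] := by
    intro n
    have h1 := hnext (s n)
    have h2 := hlast (s (n + 1))
    change (next (s n)).1 = _ at h1
    change (next (s n)).1.getLast? = some (last (next (s n))) at h2
    change (next (s n)).1 = (s n).1 ++ [last (next (s n))]
    rw [h1] at h2 ⊢
    simp at h2
    rw [← h2]
  have h0 : last (s 0) = G.init := by
    have := hlast (s 0)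
    change [G.init].getLast? = _ at this
    simpa using this.symm
  let ρ : ℕ → V := fun n => last (s n)
  have hseg : ∀ n, initialSegment ρ n = (s n).1 := by
    intro n
    induction n with
    | zero =>
      change [last (s 0)] = [G.init]
      rw [h0]
    | succ n ih => rw [initialSegment_succ, ih, hs n]
  have hstep : ∀ n, ρ (n + 1) =
      (σ (G.owner (ρ n))).1 ⟨(s n).1, (s n).2, ρ n, hlast (s n), rfl⟩ := by
    intro n
    have h1 : (s (n + 1)).1 = _ := hnext (s n)
    rw [hs n] at h1
    simpa using h1
  have hplay : G.IsPlay ρ := ⟨h0, fun i => by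
    rw [hstep i]; exact (σ (G.owner (ρ i))).2 _ _ (hlast (s i))⟩
  refine ⟨⟨ρ, hplay⟩, fun i => ?_, ?_⟩
  · change ρ (i + 1) = _
    rw [hstep i]
    have : (⟨(s i).1, (s i).2, ρ i, hlast (s i), rfl⟩ : G.HistOf (G.owner (ρ i))) =
        G.prefixHist hplay i := Subtype.ext (hseg i).symm
    rw [this]
  · rintro ⟨ρ', hρ'⟩ hgen
    have hall : ∀ n, initialSegment ρ' n = initialSegment ρ n ∧ ρ' n = ρ n := by
      intro n
      induction n with
      | zero =>
        have : ρ' 0 = ρ 0 := hρ'.1.trans hplay.1.symm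
        exact ⟨by simp [initialSegment, this], this⟩
      | succ n ih =>
        have h1 : ρ' (n + 1) = ρ (n + 1) := by
          have hg : ρ' (n + 1) = (σ (G.owner (ρ' n))).1 (G.prefixHist hρ' n) := hgen n
          rw [hg, hstep n]
          have aux : ∀ (v w : V) (a : G.HistOf (G.owner v)) (b : G.HistOf (G.owner w)),
              v = w → a.1 = b.1 → (σ (G.owner v)).1 a = (σ (G.owner w)).1 b := by
            rintro v w a b rfl hab
            rw [Subtype.ext hab]
          exact aux _ _ _ _ ih.2 (ih.1.trans (hseg n))
        exact ⟨by rw [initialSegment_succ, initialSegment_succ, ih.1, h1], h1⟩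
    exact Subtype.ext (funext fun n => (hall n).2)

/-- The outcome of a strategy profile: the unique play that it generates. -/
noncomputable def out (σ : G.Profile) : G.Play :=
  (G.existsUnique_generates σ).choose

/-- The set of vertices that occur infinitely often in a play. -/
def Inf (ρ : G.Play) : Set V :=
  {v | ∀ i, ∃ j ≥ i, ρ.1 j = v}

/-- The Muller objective given by a family of sets of vertices. -/
def Muller (F : Set (Set V)) : Set G.Play :=
  {ρ | G.Inf ρ ∈ F}

/-- The set of winners of a strategy profile for an objective profile. -/
def Win (σ : G.Profile) (α : P → Set G.Play) : Set P :=
  {p | G.out σ ∈ α p}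

/-- `σ` is a Nash equilibrium for the objective profile `α`. -/
def IsNash (σ : G.Profile) (α : P → Set G.Play) : Prop :=
  ∀ (p : P) (τ : G.Strategy p), p ∈ G.Win (σ.deviate p τ) α → p ∈ G.Win σ α

/-- `σ` is an `(α₁, …, αₙ)`-Nash equilibrium. -/
def IsMultiNash {n : ℕ} (σ : G.Profile) (α : Fin n → P → Set G.Play) : Prop :=
  ∀ j, G.IsNash σ (α j)

end GameArena

/-- Finite inputs of the decision problem.  Players and vertices are numbered from `0`; a set of
vertices is a list of vertices, a Muller objective is a list of sets of vertices, an objective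
profile is the list of the objectives of all players. -/
structure GameInput where
  numPlayers : ℕ
  numVertices : ℕ
  owner : List ℕ
  init : ℕ
  edges : List (ℕ × ℕ)
  profiles : List (List (List (List ℕ)))

/-- An input as a tuple of its components. -/
def GameInput.equivProd : GameInput ≃
    ℕ × ℕ × List ℕ × ℕ × List (ℕ × ℕ) × List (List (List (List ℕ))) where
  toFun c := (c.numPlayers, c.numVertices, c.owner, c.init, c.edges, c.profiles)
  invFun t := ⟨t.1, t.2.1, t.2.2.1, t.2.2.2.1, t.2.2.2.2.1, t.2.2.2.2.2⟩
  left_inv _ := rfl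
  right_inv _ := rfl

instance : Primcodable GameInput :=
  Primcodable.ofEquiv _ GameInput.equivProd

/-- The input `c` describes the arena `G` together with the Muller families `F j p` of the
objective profiles `j = 0, …, n - 1` and players `p`, with respect to numberings `eP` and `eV` of
the players and the vertices. -/
structure GameInput.Encodes {P V : Type*} {n : ℕ} (c : GameInput) (eP : P ≃ Fin c.numPlayers)
    (eV : V ≃ Fin c.numVertices) (G : GameArena P V) (F : Fin n → P → Set (Set V)) : Prop where
  owner : ∀ v, c.owner[(eV v).val]? = some (eP (G.owner v)).val
  init : c.init = (eV G.init).val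
  edges : ∀ u v, G.E u v ↔ ((eV u).val, (eV v).val) ∈ c.edges
  length_profiles : c.profiles.length = n
  profiles : ∀ j p, ∃ prof, c.profiles[j.val]? = some prof ∧
    ∃ fam, prof[(eP p).val]? = some fam ∧
      ∀ S : Set V, S ∈ F j p ↔ ∃ l ∈ fam, ∀ v, v ∈ S ↔ (eV v).val ∈ l

/-- Every finite arena with finitely many profiles of Muller families is described by an input. -/
theorem GameInput.exists_encodes {P V : Type*} [Finite P] [Finite V] {n : ℕ} (G : GameArena P V)
    (F : Fin n → P → Set (Set V)) :
    ∃ (c : GameInput) (eP : P ≃ Fin c.numPlayers) (eV : V ≃ Fin c.numVertices),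
      c.Encodes eP eV G F := by
  classical
  obtain ⟨k, ⟨eP⟩⟩ := Finite.exists_equiv_fin P
  obtain ⟨m, ⟨eV⟩⟩ := Finite.exists_equiv_fin V
  have hset : ∀ S : Set V, ∃ l : List ℕ, ∀ v, v ∈ S ↔ (eV v).val ∈ l := by
    intro S
    refine ⟨(S.toFinite.toFinset.image fun v => (eV v).val).toList, fun v => ?_⟩
    simp only [Finset.mem_toList, Finset.mem_image, Set.Finite.mem_toFinset]
    exact ⟨fun h => ⟨v, h, rfl⟩, fun ⟨w, hw, h⟩ => eV.injective (Fin.ext h) ▸ hw⟩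
  choose code hcode using hset
  have hfam : ∀ A : Set (Set V), ∃ fam : List (List ℕ), ∀ S : Set V,
      S ∈ A ↔ ∃ l ∈ fam, ∀ v, v ∈ S ↔ (eV v).val ∈ l := by
    intro A
    refine ⟨(A.toFinite.toFinset.image code).toList, fun S => ?_⟩
    simp only [Finset.mem_toList, Finset.mem_image, Set.Finite.mem_toFinset]
    constructor
    · exact fun h => ⟨_, ⟨S, h, rfl⟩, hcode S⟩
    · rintro ⟨_, ⟨T, hT, rfl⟩, h⟩
      have : S = T := Set.ext fun v => (h v).trans (hcode T v).symm
      exact this ▸ hT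
  choose fam hfam using hfam
  refine ⟨⟨k, m, List.ofFn fun i => (eP (G.owner (eV.symm i))).val, (eV G.init).val,
    ((Set.toFinite {e : V × V | G.E e.1 e.2}).toFinset.image
      fun e => ((eV e.1).val, (eV e.2).val)).toList,
    List.ofFn fun j => List.ofFn fun i => fam (F j (eP.symm i))⟩, eP, eV, ?_, rfl, ?_, ?_, ?_⟩
  · intro v
    simp
  · intro u v
    simp only [Finset.mem_toList, Finset.mem_image, Set.Finite.mem_toFinset, Set.mem_ofPred_eq,
      Prod.mk.injEq]
    constructor
    · exact fun h => ⟨(u, v), h, rfl, rfl⟩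
    · rintro ⟨⟨a, b⟩, h, h1, h2⟩
      rw [← eV.injective (Fin.ext h1), ← eV.injective (Fin.ext h2)]
      exact h
  · simp
  · intro j p
    refine ⟨List.ofFn fun i => fam (F j (eP.symm i)), by simp,
      fam (F j p), by simp, hfam _⟩

/-!
A profile `σ` with outcome `ρ` is an equilibrium for all objective profiles if and only if no player
`p` can deviate to a play that she wins for some profile `j` for which she loses `ρ`.  Which plays
these are depends only on the set `I` of vertices that `ρ` visits infinitely often, and they form
again a Muller objective, `improving F p I`.  Hence an equilibrium exists if and only if there is a
play `ρ` such that, in the zero-sum Muller game of each player `p` with this objective against the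
coalition of all others, `p` does not win from any vertex of `ρ`.  In one direction a winning
strategy of `p` would be a profitable deviation (`GameArena.IsMultiNash.not_forces`); in the other
the coalition punishes the first player who leaves `ρ` by a winning strategy
(`GameArena.exists_isMultiNash`).

Muller games on finite graphs are determined with finite memory (`forces_or_forces_compl`).  A
finite-memory strategy is represented as a finite graph of positions (`IsStrategyGraph`) all of
whose infinite paths are won; such graphs are easily glued together.  Determinacy is proved by
induction on the number of vertices.  If one player wins somewhere, then the remaining vertices form
a smaller game which the opponent must win.  If the player who likes the set `A` of all vertices had
an opponent who wins nowhere, then by induction this player can, from every vertex, win or reach any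
given vertex; trying to reach all vertices cyclically, she wins (`Forces.of_round_robin`).

The sets of vertices visited infinitely often by paths in a finite graph are the strongly connected
ones (`exists_path_infSet_eq_iff`), so whether a finite graph is a winning strategy graph is a
condition with bounded quantifiers over numbers and bit masks (`GameInput.IsCertificate`), hence
primitive recursive.  By determinacy an unbounded search for strategy graphs that decide all of the
finitely many games terminates (`GameInput.exists_isComplete`), and given these, the existence of
the play `ρ` is again a bounded condition (`GameInput.HasEquilibrium`).
-/

/-! ### Vertices visited infinitely often -/

/-- The set of values that a sequence takes infinitely often. -/
def infSet {V : Type*} (ρ : ℕ → V) : Set V :=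
  {v | ∀ i, ∃ j ≥ i, ρ j = v}

theorem infSet_shift {V : Type*} (ρ : ℕ → V) (N : ℕ) :
    infSet (fun i => ρ (i + N)) = infSet ρ := by
  ext v
  constructor
  · intro h i
    obtain ⟨j, hj, rfl⟩ := h i
    exact ⟨j + N, by omega, rfl⟩
  · intro h i
    obtain ⟨j, hj, rfl⟩ := h (i + N)
    exact ⟨j - N, by omega, by simp only; congr 1; omega⟩

theorem infSet_comp_equiv {V W : Type*} (e : V ≃ W) (ρ : ℕ → V) :
    infSet (fun i => e (ρ i)) = e.symm ⁻¹' infSet ρ := by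
  ext w
  simp only [infSet, Set.mem_ofPred_eq, Set.mem_preimage, Equiv.eq_symm_apply]

/-- A sequence in a finite type eventually takes only values that it takes infinitely often. -/
theorem eventually_mem_infSet {X : Type*} [Finite X] (π : ℕ → X) :
    ∃ N, ∀ i ≥ N, π i ∈ infSet π := by
  have h : ∀ x : X, ∃ N, x ∉ infSet π → ∀ j ≥ N, π j ≠ x := by
    intro x
    by_cases hx : x ∈ infSet π
    · exact ⟨0, fun h => absurd hx h⟩
    · simp only [infSet, Set.mem_ofPred_eq, not_forall, not_exists, not_and] at hx
      obtain ⟨N, hN⟩ := hx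
      exact ⟨N, fun _ j hj => hN j hj⟩
  choose N hN using h
  obtain ⟨M, hM⟩ := (Set.finite_range N).bddAbove
  refine ⟨M, fun i hi => ?_⟩
  by_contra hc
  exact hN _ hc i ((hM ⟨_, rfl⟩).trans hi) rfl

/-- The values taken infinitely often under `f ∘ π` are the images of those under `π`. -/
theorem infSet_comp {X V : Type*} [Finite X] (f : X → V) (π : ℕ → X) :
    infSet (fun i => f (π i)) = f '' infSet π := by
  ext v
  constructor
  · intro h
    obtain ⟨N, hN⟩ := eventually_mem_infSet π
    obtain ⟨j, hj, rfl⟩ := h N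
    exact ⟨_, hN j hj, rfl⟩
  · rintro ⟨x, hx, rfl⟩ i
    obtain ⟨j, hj, rfl⟩ := hx i
    exact ⟨j, hj, rfl⟩

/-! ### Finite-memory determinacy of Muller games -/

/-- A strategy graph of a player who owns the vertices in `O` and wants the set of vertices visited
infinitely often to lie in `F`, in the game on the vertices `A` with edges `E`.  Its nodes `x : X`
are pairs of a memory state and a vertex, of which only the vertex `lab x` matters.  Every infinite
path must be won by the player.  Nodes over the exit set `T` may be dead ends: there the player is
content with having reached `T`. -/
structure IsStrategyGraph {V : Type*} (E : V → V → Prop) (O : Set V) (F : Set (Set V))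
    (A T : Set V) {X : Type*} (lab : X → V) (R : X → X → Prop) : Prop where
  mem : ∀ x, lab x ∈ A
  edge : ∀ x y, R x y → E (lab x) (lab y)
  own : ∀ x, lab x ∈ O → lab x ∉ T → ∃ y, R x y
  opp : ∀ x, lab x ∉ O → lab x ∉ T → ∀ w ∈ A, E (lab x) w → ∃ y, R x y ∧ lab y = w
  win : ∀ π : ℕ → X, (∀ i, R (π i) (π (i + 1))) → infSet (fun i => lab (π i)) ∈ F

/-- The player has a finite strategy graph with a node over `v`. -/
def Forces {V : Type*} (E : V → V → Prop) (O : Set V) (F : Set (Set V)) (A T : Set V) (v : V) :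
    Prop :=
  ∃ (X : Type) (_ : Finite X) (lab : X → V) (R : X → X → Prop),
    IsStrategyGraph E O F A T lab R ∧ v ∈ Set.range lab

section Determinacy

variable {V : Type} {E : V → V → Prop} {O : Set V} {F : Set (Set V)} {A T : Set V}

theorem Forces.mem {v : V} (h : Forces E O F A T v) : v ∈ A := by
  obtain ⟨X, _, lab, R, hG, x, rfl⟩ := h
  exact hG.mem x

/-- A subarena which the opponent cannot leave inherits its strategy graphs to the whole arena. -/
theorem Forces.of_trap {A' : Set V} {v : V} (h : Forces E O F A' T v) (hA : A' ⊆ A)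
    (htrap : ∀ v ∈ A', v ∉ O → ∀ w ∈ A, E v w → w ∈ A') : Forces E O F A T v := by
  obtain ⟨X, hX, lab, R, hG, hv⟩ := h
  exact ⟨X, hX, lab, R, ⟨fun x => hA (hG.mem x), hG.edge, hG.own,
    fun x hx hT w hw hE => hG.opp x hx hT w (htrap _ (hG.mem x) hx w hw hE) hE, hG.win⟩, hv⟩

/-- A path in a disjoint union stays in one of the summands. -/
theorem exists_sigma_path {ι : Type*} {X : ι → Type*} {R : ∀ i, X i → X i → Prop}
    (π : ℕ → Σ i, X i)
    (hπ : ∀ n, ∃ i x y, π n = ⟨i, x⟩ ∧ π (n + 1) = ⟨i, y⟩ ∧ R i x y) :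
    ∃ i, ∃ π' : ℕ → X i, (∀ n, π n = ⟨i, π' n⟩) ∧ ∀ n, R i (π' n) (π' (n + 1)) := by
  obtain ⟨i, x₀, -, h0, -⟩ := hπ 0
  have hc : ∀ n, ∃ x : X i, π n = ⟨i, x⟩ := by
    intro n
    induction n with
    | zero => exact ⟨x₀, h0⟩
    | succ n ih =>
      obtain ⟨x, hx⟩ := ih
      obtain ⟨j, x', y, h1, h2, -⟩ := hπ n
      obtain rfl : i = j := congrArg Sigma.fst (hx.symm.trans h1)
      exact ⟨y, h2⟩
  choose π' hπ' using hc
  refine ⟨i, π', hπ', fun n => ?_⟩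
  obtain ⟨j, x, y, h1, h2, h3⟩ := hπ n
  rw [hπ'] at h1 h2
  obtain rfl : i = j := congrArg Sigma.fst h1
  rw [eq_of_heq (Sigma.mk.inj h1).2, eq_of_heq (Sigma.mk.inj h2).2]
  exact h3

/-- The disjoint union of strategy graphs is a strategy graph, so a single one covers all vertices
from which there is any. -/
theorem exists_cover [Finite V] (E : V → V → Prop) (O : Set V) (F : Set (Set V)) (A T : Set V) :
    ∃ (X : Type) (_ : Finite X) (lab : X → V) (R : X → X → Prop),
      IsStrategyGraph E O F A T lab R ∧ ∀ v, Forces E O F A T v → v ∈ Set.range lab := by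
  choose X hX lab R hG hr using fun v : {v // Forces E O F A T v} => v.2
  refine ⟨Σ v, X v, inferInstance, fun p => lab p.1 p.2,
    fun p q => ∃ v x y, p = ⟨v, x⟩ ∧ q = ⟨v, y⟩ ∧ R v x y, ⟨?_, ?_, ?_, ?_, ?_⟩, ?_⟩
  · exact fun p => (hG p.1).mem p.2
  · rintro _ _ ⟨v, x, y, rfl, rfl, h⟩
    exact (hG v).edge x y h
  · rintro ⟨v, x⟩ h1 h2
    obtain ⟨y, hy⟩ := (hG v).own x h1 h2
    exact ⟨⟨v, y⟩, v, x, y, rfl, rfl, hy⟩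
  · rintro ⟨v, x⟩ h1 h2 w hw hE
    obtain ⟨y, hy, rfl⟩ := (hG v).opp x h1 h2 w hw hE
    exact ⟨⟨v, y⟩, ⟨v, x, y, rfl, rfl, hy⟩, rfl⟩
  · intro π hπ
    obtain ⟨v, π', h1, h2⟩ := exists_sigma_path π hπ
    have h3 : ∀ n, lab (π n).1 (π n).2 = lab v (π' n) := fun n => by rw [h1 n]
    simpa only [h3] using (hG v).win π' h2
  · intro v hv
    obtain ⟨x, hx⟩ := hr ⟨v, hv⟩
    exact ⟨⟨⟨v, hv⟩, x⟩, hx⟩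

/-- An incomplete strategy graph may use moves into the winning region: it is completed by
appending a strategy graph which covers this region. -/
theorem Forces.of_incomplete [Finite V] {Y : Type} [Finite Y] (lab : Y → V) (R : Y → Y → Prop)
    (mem : ∀ x, lab x ∈ A) (edge : ∀ x y, R x y → E (lab x) (lab y))
    (own : ∀ x, lab x ∈ O → lab x ∉ T → (∃ y, R x y) ∨ ∃ w, E (lab x) w ∧ Forces E O F A T w)
    (opp : ∀ x, lab x ∉ O → lab x ∉ T → ∀ w ∈ A, E (lab x) w →
      (∃ y, R x y ∧ lab y = w) ∨ Forces E O F A T w)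
    (win : ∀ π : ℕ → Y, (∀ i, R (π i) (π (i + 1))) → infSet (fun i => lab (π i)) ∈ F) (x : Y) :
    Forces E O F A T (lab x) := by
  obtain ⟨X, hX, labX, RX, hG, hcov⟩ := exists_cover E O F A T
  refine ⟨Y ⊕ X, inferInstance, Sum.elim lab labX, fun p q => match p, q with
    | .inl x, .inl y => R x y
    | .inl x, .inr y => E (lab x) (labX y)
    | .inr _, .inl _ => False
    | .inr x, .inr y => RX x y, ⟨?_, ?_, ?_, ?_, ?_⟩, .inl x, rfl⟩
  · rintro (x | x)
    exacts [mem x, hG.mem x]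
  · rintro (x | x) (y | y) h
    exacts [edge x y h, h, h.elim, hG.edge x y h]
  · rintro (x | x) h1 h2
    · obtain ⟨y, hy⟩ | ⟨w, hE, hw⟩ := own x h1 h2
      · exact ⟨.inl y, hy⟩
      · obtain ⟨y, rfl⟩ := hcov w hw
        exact ⟨.inr y, hE⟩
    · obtain ⟨y, hy⟩ := hG.own x h1 h2
      exact ⟨.inr y, hy⟩
  · rintro (x | x) h1 h2 w hw hE
    · obtain ⟨y, hy, rfl⟩ | hf := opp x h1 h2 w hw hE
      · exact ⟨.inl y, hy, rfl⟩
      · obtain ⟨y, rfl⟩ := hcov w hf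
        exact ⟨.inr y, hE, rfl⟩
    · obtain ⟨y, hy, rfl⟩ := hG.opp x h1 h2 w hw hE
      exact ⟨.inr y, hy, rfl⟩
  · intro π hπ
    by_cases h : ∃ N y, π N = .inr y
    · obtain ⟨N, y, hy⟩ := h
      have hr : ∀ i, ∃ z, π (i + N) = .inr z := by
        intro i
        induction i with
        | zero => exact ⟨y, by simpa using hy⟩
        | succ i ih =>
          obtain ⟨z, hz⟩ := ih
          have := hπ (i + N)
          rw [hz] at this
          rw [show i + 1 + N = i + N + 1 by omega]
          rcases h : π (i + N + 1) with u | u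
          · rw [h] at this
            exact this.elim
          · exact ⟨u, rfl⟩
      choose π' hπ' using hr
      have := hG.win π' fun i => by
        have := hπ (i + N)
        rw [show i + N + 1 = i + 1 + N by omega, hπ', hπ'] at this
        exact this
      rw [← infSet_shift _ N]
      simpa only [hπ', Sum.elim_inr] using this
    · have hl : ∀ i, ∃ z, π i = .inl z := by
        intro i
        rcases h' : π i with u | u
        · exact ⟨u, rfl⟩
        · exact (h ⟨i, u, h'⟩).elim
      choose π' hπ' using hl
      have := win π' fun i => by
        have := hπ i
        rw [hπ', hπ'] at this
        exact this
      simpa only [hπ', Sum.elim_inl] using this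

/-- A single node without edges is a strategy graph over an exit vertex, and in the two lemmas
after this one it is an incomplete strategy graph, whose first move enters the winning region. -/
theorem Forces.of_mem_exit [Finite V] {v : V} (hA : v ∈ A) (hT : v ∈ T) : Forces E O F A T v :=
  Forces.of_incomplete (Y := Unit) (fun _ => v) (fun _ _ => False) (fun _ => hA)
    (fun _ _ h => h.elim) (fun _ _ h => absurd hT h) (fun _ _ h => absurd hT h)
    (fun _ h => (h 0).elim) ()

theorem Forces.of_own [Finite V] {v w : V} (hA : v ∈ A) (hO : v ∈ O) (hE : E v w)
    (hw : Forces E O F A T w) : Forces E O F A T v :=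
  Forces.of_incomplete (Y := Unit) (fun _ => v) (fun _ _ => False) (fun _ => hA)
    (fun _ _ h => h.elim) (fun _ _ _ => .inr ⟨w, hE, hw⟩) (fun _ h => absurd hO h)
    (fun _ h => (h 0).elim) ()

theorem Forces.of_opp [Finite V] {v : V} (hA : v ∈ A) (hO : v ∉ O)
    (hw : ∀ w ∈ A, E v w → Forces E O F A T w) : Forces E O F A T v :=
  Forces.of_incomplete (Y := Unit) (fun _ => v) (fun _ _ => False) (fun _ => hA)
    (fun _ _ h => h.elim) (fun _ h => absurd h hO) (fun _ _ _ w h1 h2 => .inr (hw w h1 h2))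
    (fun _ h => (h 0).elim) ()

/-- Winning on the arena without the winning region suffices for winning. -/
theorem Forces.of_diff [Finite V] {v : V}
    (h : Forces E O F (A \ {u | Forces E O F A T u}) ∅ v) : Forces E O F A T v := by
  obtain ⟨Y, hY, lab, R, hG, x, rfl⟩ := h
  refine Forces.of_incomplete lab R (fun x => (hG.mem x).1) hG.edge
    (fun x h1 _ => .inl (hG.own x h1 (Set.notMem_empty _))) (fun x h1 _ w hw hE => ?_) hG.win x
  by_cases hf : Forces E O F A T w
  · exact .inr hf
  · exact .inl (hG.opp x h1 (Set.notMem_empty _) w ⟨hw, hf⟩ hE)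

/-- The complement of the winning region is a subarena. -/
theorem exists_succ_diff [Finite V] (hA : ∀ v ∈ A, ∃ w ∈ A, E v w) :
    ∀ v ∈ A \ {u | Forces E O F A T u}, ∃ w ∈ A \ {u | Forces E O F A T u}, E v w := by
  rintro v ⟨hv, hf⟩
  by_cases hO : v ∈ O
  · obtain ⟨w, hw, hE⟩ := hA v hv
    exact ⟨w, ⟨hw, fun h => hf (Forces.of_own hv hO hE h)⟩, hE⟩
  · by_contra hc
    refine hf (Forces.of_opp hv hO fun w hw hE => ?_)
    by_contra h
    exact hc ⟨w, ⟨hw, h⟩, hE⟩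

/-- The complement of the winning region is a trap for the player, so the opponent can use her
strategies there in the whole arena. -/
theorem Forces.of_diff_compl [Finite V] {S : Set V} {v : V}
    (h : Forces E Oᶜ Fᶜ (A \ {u | Forces E O F A T u}) S v) : Forces E Oᶜ Fᶜ A S v :=
  h.of_trap Set.sdiff_subset fun _ hv hO w hw hE =>
    ⟨hw, fun hf => hv.2 (Forces.of_own hv.1 (by simpa using hO) hE hf)⟩

/-- If a sequence in `ZMod m` increases by one at the times in `t` and is constant otherwise, and
`t` is unbounded, then every value occurs at infinitely many of the times in `t`. -/
theorem forall_exists_tick {m : ℕ} [NeZero m] (g : ℕ → ZMod m) (t : ℕ → Prop)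
    (hstay : ∀ i, ¬ t i → g (i + 1) = g i) (htick : ∀ i, t i → g (i + 1) = g i + 1)
    (ht : ∀ N, ∃ i ≥ N, t i) (k : ZMod m) : ∀ N, ∃ i ≥ N, g i = k ∧ t i := by
  have hfirst : ∀ N, ∃ i ≥ N, g i = g N ∧ t i := by
    intro N
    have hex : ∃ d, t (N + d) := by
      obtain ⟨i, hi, h⟩ := ht N
      exact ⟨i - N, by rwa [show N + (i - N) = i by omega]⟩
    classical
    refine ⟨N + Nat.find hex, by omega, ?_, Nat.find_spec hex⟩
    have : ∀ d ≤ Nat.find hex, g (N + d) = g N := by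
      intro d
      induction d with
      | zero => simp
      | succ d ih =>
        intro hd
        rw [← add_assoc, hstay _ (Nat.find_min hex (by omega)), ih (by omega)]
    exact this _ le_rfl
  intro N
  have hplus : ∀ d : ℕ, ∃ i ≥ N, g i = g N + d ∧ t i := by
    intro d
    induction d with
    | zero => simpa using hfirst N
    | succ d ih =>
      obtain ⟨i, hi, h1, h2⟩ := ih
      obtain ⟨j, hj, h3, h4⟩ := hfirst (i + 1)
      refine ⟨j, by omega, ?_, h4⟩
      rw [h3, htick i h2, h1]
      push_cast
      ring
  obtain ⟨i, hi, h1, h2⟩ := hplus (k - g N).val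
  exact ⟨i, hi, by simpa using h1, h2⟩

/-- If the player wants to visit all vertices infinitely often, and can from everywhere win or
reach any given vertex, then she wins: she tries to reach all vertices cyclically.  Either she
succeeds infinitely often, or at some time she wins while trying to reach the next vertex. -/
theorem Forces.of_round_robin [Finite V] (hF : A ∈ F) (hA : ∀ v ∈ A, ∃ w ∈ A, E v w)
    (h : ∀ v ∈ A, ∀ u ∈ A, Forces E O F A {v} u) : ∀ v ∈ A, Forces E O F A ∅ v := by
  intro v₀ hv₀
  have : Nonempty A := ⟨⟨v₀, hv₀⟩⟩
  have : NeZero (Nat.card A) := ⟨Nat.card_pos.ne'⟩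
  obtain ⟨e⟩ : Nonempty (ZMod (Nat.card A) ≃ A) := by
    rw [← Finite.card_eq, Nat.card_zmod]
  choose X hX lab R hG hcov using fun k => exists_cover E O F A {(e k : V)}
  have hcov' : ∀ k, ∀ u ∈ A, ∃ x, lab k x = u := fun k u hu => hcov k u (h _ (e k).2 u hu)
  have : Finite (ZMod (Nat.card A)) := Finite.of_equiv _ e.symm
  obtain ⟨x₀, hx₀⟩ := hcov' 0 v₀ hv₀
  refine ⟨Σ k, X k, inferInstance, fun p => lab p.1 p.2, fun p q =>
    (lab p.1 p.2 ≠ e p.1 ∧ ∃ k x y, p = ⟨k, x⟩ ∧ q = ⟨k, y⟩ ∧ R k x y) ∨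
    (lab p.1 p.2 = e p.1 ∧ q.1 = p.1 + 1 ∧ E (lab p.1 p.2) (lab q.1 q.2)),
    ⟨?_, ?_, ?_, ?_, ?_⟩, ⟨0, x₀⟩, hx₀⟩
  · exact fun p => (hG p.1).mem p.2
  · rintro p q (⟨-, k, x, y, rfl, rfl, h⟩ | ⟨-, -, h⟩)
    exacts [(hG k).edge x y h, h]
  · rintro ⟨k, x⟩ hO -
    by_cases hx : lab k x = e k
    · obtain ⟨w, hw, hE⟩ := hA _ ((hG k).mem x)
      obtain ⟨y, rfl⟩ := hcov' (k + 1) w hw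
      exact ⟨⟨k + 1, y⟩, .inr ⟨hx, rfl, hE⟩⟩
    · obtain ⟨y, hy⟩ := (hG k).own x hO hx
      exact ⟨⟨k, y⟩, .inl ⟨hx, k, x, y, rfl, rfl, hy⟩⟩
  · rintro ⟨k, x⟩ hO - w hw hE
    by_cases hx : lab k x = e k
    · obtain ⟨y, rfl⟩ := hcov' (k + 1) w hw
      exact ⟨⟨k + 1, y⟩, .inr ⟨hx, rfl, hE⟩, rfl⟩
    · obtain ⟨y, hy, rfl⟩ := (hG k).opp x hO hx w hw hE
      exact ⟨⟨k, y⟩, .inl ⟨hx, k, x, y, rfl, rfl, hy⟩, rfl⟩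
  · intro π hπ
    by_cases ht : ∀ N, ∃ i ≥ N, lab (π i).1 (π i).2 = e (π i).1
    · have key := forall_exists_tick (fun i => (π i).1) (fun i => lab (π i).1 (π i).2 = e (π i).1)
        (fun i hi => by
          obtain ⟨-, k, x, y, h1, h2, -⟩ | ⟨h, -⟩ := hπ i
          · simp only [h1, h2]
          · exact (hi h).elim)
        (fun i hi => by
          obtain ⟨h, -⟩ | ⟨-, h, -⟩ := hπ i
          · exact (h hi).elim
          · exact h) ht
      convert hF
      ext v
      constructor
      · intro hv
        obtain ⟨i, -, rfl⟩ := hv 0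
        exact (hG _).mem _
      · intro hv N
        obtain ⟨i, hi, h1, h2⟩ := key (e.symm ⟨v, hv⟩) N
        exact ⟨i, hi, by simp only [h2, h1, e.apply_symm_apply]⟩
    · push Not at ht
      obtain ⟨N, hN⟩ := ht
      obtain ⟨k, π', h1, h2⟩ := exists_sigma_path (R := R) (fun i => π (i + N)) fun i => by
        obtain ⟨-, h⟩ | ⟨h, -⟩ := hπ (i + N)
        · rwa [show i + 1 + N = i + N + 1 by omega]
        · exact (hN _ (by omega) h).elim
      rw [← infSet_shift _ N]
      have h3 : ∀ i, lab (π (i + N)).1 (π (i + N)).2 = lab k (π' i) := fun i => by rw [h1 i]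
      simpa only [h3] using (hG k).win π' h2

/-- Finite-memory determinacy of Muller games, in which the opponent owns the vertices outside `O`
and wins the plays which the player loses. -/
theorem forces_or_forces_compl [Finite V] (E : V → V → Prop) (O : Set V) (F : Set (Set V))
    (A : Set V) (hA : ∀ v ∈ A, ∃ w ∈ A, E v w) :
    ∀ v ∈ A, Forces E O F A ∅ v ∨ Forces E Oᶜ Fᶜ A ∅ v := by
  induction hc : A.ncard using Nat.strong_induction_on generalizing A O F with
  | _ n ih =>
    subst hc
    -- If the player wins somewhere, then all other vertices are won by the opponent.
    have key : ∀ (O : Set V) (F : Set (Set V)) (u : V), Forces E O F A ∅ u →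
        ∀ v ∈ A, Forces E O F A ∅ v ∨ Forces E Oᶜ Fᶜ A ∅ v := by
      intro O F u hu v hv
      by_contra! hcon
      have hlt : (A \ {u | Forces E O F A ∅ u}).ncard < A.ncard :=
        Set.ncard_lt_ncard ⟨Set.sdiff_subset, fun hs => (hs hu.mem).2 hu⟩
      obtain h | h := ih _ hlt O F _ (exists_succ_diff hA) rfl v ⟨hv, hcon.1⟩
      · exact hcon.1 h.of_diff
      · exact hcon.2 h.of_diff_compl
    -- If the opponent wins nowhere, then a player who wants to visit all vertices wins.
    have key' : ∀ (O : Set V) (F : Set (Set V)), A ∈ F →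
        (∀ u, ¬ Forces E Oᶜ Fᶜ A ∅ u) → ∀ v ∈ A, Forces E O F A ∅ v := by
      intro O F hF hno
      refine Forces.of_round_robin hF hA fun t ht u hu => ?_
      by_contra hcon
      have hlt : (A \ {u | Forces E O F A {t} u}).ncard < A.ncard :=
        Set.ncard_lt_ncard ⟨Set.sdiff_subset,
          fun hs => (hs ht).2 (Forces.of_mem_exit ht rfl)⟩
      obtain h | h := ih _ hlt O F _ (exists_succ_diff hA) rfl u ⟨hu, hcon⟩
      · exact hcon h.of_diff
      · exact hno _ h.of_diff_compl
    intro v hv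
    by_contra! hcon
    have h1 : ∀ u, ¬ Forces E O F A ∅ u := fun u hu => by
      obtain h | h := key O F u hu v hv
      exacts [hcon.1 h, hcon.2 h]
    have h2 : ∀ u, ¬ Forces E Oᶜ Fᶜ A ∅ u := fun u hu => by
      obtain h | h := key Oᶜ Fᶜ u hu v hv
      · exact hcon.2 h
      · rw [compl_compl, compl_compl] at h
        exact hcon.1 h
    by_cases hF : A ∈ F
    · exact hcon.1 (key' O F hF h2 v hv)
    · exact hcon.2 (key' Oᶜ Fᶜ hF (by rwa [compl_compl, compl_compl]) v hv)

end Determinacy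

/-! ### Infinite paths with a prescribed set of recurring vertices -/

/-- `Y` is non-empty and strongly connected: every set `Z` that contains the successors of `x` in
`Y` and is closed under successors in `Y` contains all of `Y`.  Quantifying over sets rather than
paths makes this a bounded condition on bit masks. -/
def IsRecurrent {X : Type*} (R : X → X → Prop) (Y : Set X) : Prop :=
  (∃ x, x ∈ Y) ∧ ∀ x, x ∈ Y → ∀ y, y ∈ Y → ∀ Z : Set X, (∀ z, z ∈ Y → R x z → z ∈ Z) →
    (∀ z, z ∈ Z → ∀ w, w ∈ Y → R z w → w ∈ Z) → y ∈ Z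

theorem mem_of_closed {X : Type*} {π : ℕ → X} {N : ℕ} {Z : Set X} (hN : π N ∈ Z)
    (hZ : ∀ i ≥ N, π i ∈ Z → π (i + 1) ∈ Z) : ∀ i ≥ N, π i ∈ Z := by
  intro i hi
  induction i, hi using Nat.le_induction with
  | base => exact hN
  | succ i hi ih => exact hZ i hi ih

theorem isRecurrent_infSet {X : Type*} [Finite X] {R : X → X → Prop} {π : ℕ → X}
    (hπ : ∀ i, R (π i) (π (i + 1))) : IsRecurrent R (infSet π) := by
  obtain ⟨N, hN⟩ := eventually_mem_infSet π
  refine ⟨⟨π N, hN N le_rfl⟩, fun x hx y hy Z h1 h2 => ?_⟩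
  obtain ⟨i, hi, rfl⟩ := hx N
  obtain ⟨j, hj, rfl⟩ := hy (i + 1)
  refine mem_of_closed (N := i + 1) ?_ ?_ j hj
  · exact h1 _ (hN _ (by omega)) (hπ i)
  · exact fun k hk hZ => h2 _ hZ _ (hN _ (by omega)) (hπ k)

/-- If `y` can be reached by at least one step from everywhere, then there is a distance to `y`
which can be decreased by a step until `y` is reached. -/
theorem exists_distance {X : Type*} (R : X → X → Prop) (y : X) :
    ∃ D : X → ℕ, ∀ x, Relation.TransGen R x y → ∃ x', R x x' ∧ (x' = y ∨ D x' < D x) := by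
  let S : ℕ → Set X := fun n => Nat.rec {x | R x y} (fun _ s => {x | ∃ x' ∈ s, R x x'}) n
  have hS : ∀ x, Relation.TransGen R x y → ∃ n, x ∈ S n := by
    intro x hx
    induction hx using Relation.TransGen.head_induction_on with
    | single h => exact ⟨0, h⟩
    | head h _ ih =>
      obtain ⟨n, hn⟩ := ih
      exact ⟨n + 1, _, hn, h⟩
  refine ⟨fun x => sInf {n | x ∈ S n}, fun x hx => ?_⟩
  have hmem : x ∈ S (sInf {n | x ∈ S n}) := Nat.sInf_mem (hS x hx)
  rcases hn : sInf {n | x ∈ S n} with _ | n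
  · rw [hn] at hmem
    exact ⟨y, hmem, .inl rfl⟩
  · rw [hn] at hmem
    obtain ⟨x', hx', hR⟩ := hmem
    exact ⟨x', hR, .inr (by
      show sInf {n | x' ∈ S n} < _
      have : sInf {n | x' ∈ S n} ≤ n := Nat.sInf_le hx'
      simp only [hn]
      omega)⟩

/-- In a strongly connected set there is an infinite path which visits exactly its vertices
infinitely often: it runs towards the members of a sequence in which all vertices recur. -/
theorem IsRecurrent.exists_path {X : Type*} [Countable X] {R : X → X → Prop} {Y : Set X}
    (hY : IsRecurrent R Y) {x₀ : X} (hx₀ : x₀ ∈ Y) :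
    ∃ π : ℕ → X, π 0 = x₀ ∧ (∀ i, R (π i) (π (i + 1))) ∧ infSet π = Y := by
  classical
  have htrans : ∀ x ∈ Y, ∀ y ∈ Y, Relation.TransGen (fun u v => R u v ∧ v ∈ Y) x y := by
    intro x hx y hy
    exact hY.2 x hx y hy {z | Relation.TransGen (fun u v => R u v ∧ v ∈ Y) x z}
      (fun z hz hR => .single ⟨hR, hz⟩) (fun z hz w hw hR => hz.tail ⟨hR, hw⟩)
  choose D hD using fun y => exists_distance (fun u v => R u v ∧ v ∈ Y) y
  have : Nonempty Y := ⟨⟨x₀, hx₀⟩⟩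
  obtain ⟨f, hf⟩ := exists_surjective_nat Y
  let e : ℕ → Y := fun k => f k.unpair.1
  have he : ∀ y : Y, ∀ k, ∃ k' ≥ k, e k' = y := by
    intro y k
    obtain ⟨a, rfl⟩ := hf y
    exact ⟨Nat.pair a k, Nat.right_le_pair a k, by simp [e]⟩
  choose! nx hnx using fun (y : X) (x : X) (h : x ∈ Y ∧ y ∈ Y) => hD y x (htrans x h.1 y h.2)
  let step : X × ℕ → X × ℕ := fun p =>
    (nx (e p.2) p.1, if nx (e p.2) p.1 = e p.2 then p.2 + 1 else p.2)
  let s : ℕ → X × ℕ := fun n => Nat.rec (x₀, 0) (fun _ p => step p) n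
  have hs : ∀ n, s (n + 1) = step (s n) := fun n => rfl
  have hsY : ∀ n, (s n).1 ∈ Y := by
    intro n
    induction n with
    | zero => exact hx₀
    | succ n ih => exact (hnx (e (s n).2) (s n).1 ⟨ih, (e _).2⟩).1.2
  -- The current target is reached, and then replaced by the next one.
  have hreach : ∀ d n, D (e (s n).2) (s n).1 ≤ d →
      ∃ j ≥ n + 1, (s j).1 = e (s n).2 ∧ (s j).2 = (s n).2 + 1 := by
    intro d
    induction d with
    | zero =>
      intro n hd
      have h := (hnx (e (s n).2) (s n).1 ⟨hsY n, (e _).2⟩).2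
      have h' : nx (e (s n).2) (s n).1 = e (s n).2 := h.resolve_right (by omega)
      exact ⟨n + 1, le_rfl, by rw [hs]; exact h', by rw [hs]; simp only [step, h', if_true]⟩
    | succ d ih =>
      intro n hd
      have h := (hnx (e (s n).2) (s n).1 ⟨hsY n, (e _).2⟩).2
      by_cases h' : nx (e (s n).2) (s n).1 = e (s n).2
      · exact ⟨n + 1, le_rfl, by rw [hs]; exact h', by rw [hs]; simp only [step, h', if_true]⟩
      · have h2 : (s (n + 1)).2 = (s n).2 := by rw [hs]; simp only [step, h', if_false]
        have h1 : (s (n + 1)).1 = nx (e (s n).2) (s n).1 := rfl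
        obtain ⟨j, hj, h3, h4⟩ := ih (n + 1) (by
          rw [h2, h1]
          have := h.resolve_left h'
          omega)
        exact ⟨j, by omega, by rw [h3, h2], by rw [h4, h2]⟩
  have hgoal : ∀ n d, ∃ j ≥ n, (s j).2 = (s n).2 + d := by
    intro n d
    induction d with
    | zero => exact ⟨n, le_rfl, rfl⟩
    | succ d ih =>
      obtain ⟨j, hj, h⟩ := ih
      obtain ⟨j', hj', -, h'⟩ := hreach _ j le_rfl
      exact ⟨j', by omega, by rw [h', h]; omega⟩
  refine ⟨fun n => (s n).1, rfl, fun n => (hnx (e (s n).2) (s n).1 ⟨hsY n, (e _).2⟩).1.1, ?_⟩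
  ext y
  constructor
  · intro hy
    obtain ⟨j, -, rfl⟩ := hy 0
    exact hsY j
  · intro hy n
    obtain ⟨k, hk, hek⟩ := he ⟨y, hy⟩ (s n).2
    obtain ⟨j, hj, h⟩ := hgoal n (k - (s n).2)
    obtain ⟨j', hj', h', -⟩ := hreach _ j le_rfl
    refine ⟨j', by omega, ?_⟩
    simp only [h', h, show (s n).2 + (k - (s n).2) = k by omega, hek]

/-- There is an infinite path from `a` which visits exactly the vertices of `Y` infinitely often if
and only if `Y` is strongly connected and every closed set which contains `a` meets `Y`. -/
theorem exists_path_infSet_eq_iff {X : Type*} [Finite X] {R : X → X → Prop} {Y : Set X} {a : X} :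
    (∃ π : ℕ → X, π 0 = a ∧ (∀ i, R (π i) (π (i + 1))) ∧ infSet π = Y) ↔
      IsRecurrent R Y ∧ ∀ Z : Set X, a ∈ Z → (∀ z, z ∈ Z → ∀ w, R z w → w ∈ Z) →
        ∃ y, y ∈ Y ∧ y ∈ Z := by
  constructor
  · rintro ⟨π, rfl, hR, rfl⟩
    refine ⟨isRecurrent_infSet hR, fun Z h0 hZ => ?_⟩
    obtain ⟨N, hN⟩ := eventually_mem_infSet π
    exact ⟨π N, hN N le_rfl, mem_of_closed (N := 0) h0 (fun i _ h => hZ _ h _ (hR i)) N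
      (Nat.zero_le _)⟩
  · rintro ⟨hY, hZ⟩
    obtain ⟨y, hy, hay⟩ := hZ {z | Relation.ReflTransGen R a z} .refl fun z hz w hR => hz.tail hR
    clear hZ
    change Relation.ReflTransGen R a y at hay
    induction hay using Relation.ReflTransGen.head_induction_on with
    | refl => exact hY.exists_path hy
    | @head b c hbc hcy ih =>
      obtain ⟨π, rfl, h1, h2⟩ := ih
      let ρ : ℕ → X := fun n => Nat.casesOn n b π
      refine ⟨ρ, rfl, fun i => ?_, ?_⟩
      · cases i with
        | zero => exact hbc
        | succ i => exact h1 i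
      · rw [← h2]
        exact (infSet_shift ρ 1).symm

/-! ### Nash equilibria and coalition strategies -/

/-- The sets of vertices which, visited infinitely often, let player `p` win for an objective
profile for which she loses when `S` is visited infinitely often. -/
def improving {P V : Type*} {n : ℕ} (F : Fin n → P → Set (Set V)) (p : P) (S : Set V) :
    Set (Set V) :=
  {S' | ∃ j, S ∉ F j p ∧ S' ∈ F j p}

/-- Every finite-state update of a memory along a play can be read off from the histories. -/
theorem exists_memory {V S : Type*} (s₀ : S) (step : S → V → S) :
    ∃ mem : List V → S, ∀ ρ : ℕ → V, mem (initialSegment ρ 0) = s₀ ∧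
      ∀ k, mem (initialSegment ρ (k + 1)) = step (mem (initialSegment ρ k)) (ρ (k + 1)) := by
  refine ⟨fun h => h.tail.foldl step s₀, fun ρ => ⟨rfl, fun k => ?_⟩⟩
  have hne : initialSegment ρ k ≠ [] := by
    simp [initialSegment]
  change (initialSegment ρ (k + 1)).tail.foldl step s₀ = _
  rw [initialSegment_succ, List.tail_append_of_ne_nil hne, List.foldl_append]
  rfl

/-- A play which follows a strategy graph from some time on is won. -/
theorem IsStrategyGraph.follow {V X : Type*} {E : V → V → Prop} {O : Set V} {F : Set (Set V)}
    {lab : X → V} {R : X → X → Prop} (hG : IsStrategyGraph E O F Set.univ ∅ lab R)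
    {next : X → V → X} (hnext : ∀ x w, (∃ y, R x y ∧ lab y = w) → R x (next x w) ∧
      lab (next x w) = w)
    {move : X → X} (hmove : ∀ x, lab x ∈ O → R x (move x))
    {ρ : ℕ → V} {i : ℕ} (hρ : ∀ k, E (ρ (i + k)) (ρ (i + k + 1))) (s : ℕ → X)
    (h0 : lab (s 0) = ρ i) (hs : ∀ k, s (k + 1) = next (s k) (ρ (i + k + 1)))
    (hO : ∀ k, lab (s k) = ρ (i + k) → ρ (i + k) ∈ O → ρ (i + k + 1) = lab (move (s k))) :
    infSet ρ ∈ F := by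
  have key : ∀ k, lab (s k) = ρ (i + k) →
      R (s k) (s (k + 1)) ∧ lab (s (k + 1)) = ρ (i + (k + 1)) := by
    intro k hk
    rw [hs k]
    refine hnext _ _ ?_
    by_cases h : ρ (i + k) ∈ O
    · exact ⟨_, hmove _ (hk ▸ h), (hO k hk h).symm⟩
    · exact hG.opp _ (hk ▸ h) (Set.notMem_empty _) _ (Set.mem_univ _) (hk ▸ hρ k)
  have hlab : ∀ k, lab (s k) = ρ (i + k) := by
    intro k
    induction k with
    | zero => exact h0
    | succ k ih => exact (key k ih).2
  have := hG.win s fun k => (key k (hlab k)).1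
  simp only [hlab, add_comm i] at this
  rwa [infSet_shift] at this

theorem IsStrategyGraph.exists_next_move {V X : Type*} {E : V → V → Prop} {O : Set V}
    {F : Set (Set V)} {lab : X → V} {R : X → X → Prop}
    (hG : IsStrategyGraph E O F Set.univ ∅ lab R) :
    ∃ (next : X → V → X) (move : X → X),
      (∀ x w, (∃ y, R x y ∧ lab y = w) → R x (next x w) ∧ lab (next x w) = w) ∧
      ∀ x, lab x ∈ O → R x (move x) := by
  classical
  refine ⟨fun x w => if h : ∃ y, R x y ∧ lab y = w then h.choose else x,
    fun x => if h : ∃ y, R x y then h.choose else x, fun x w h => ?_, fun x h => ?_⟩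
  · simp only [h, dif_pos]
    exact h.choose_spec
  · have h' := hG.own x h (Set.notMem_empty _)
    simp only [h', dif_pos]
    exact h'.choose_spec

namespace GameArena

variable {P V : Type*} {G : GameArena P V}

theorem generates_out (σ : G.Profile) : G.Generates σ (G.out σ) :=
  (G.existsUnique_generates σ).choose_spec.1

theorem out_eq {σ : G.Profile} {ρ : G.Play} (h : G.Generates σ ρ) : G.out σ = ρ :=
  (G.existsUnique_generates σ).unique (generates_out σ) h

open Classical in
/-- A strategy as a function on all lists of vertices; it has a junk value outside its domain. -/
noncomputable def act {p : P} (τ : G.Strategy p) (h : List V) : V :=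
  if hh : G.IsHistory h ∧ ∃ v, h.getLast? = some v ∧ G.owner v = p then τ.1 ⟨h, hh⟩ else G.init

theorem act_initialSegment {p : P} (τ : G.Strategy p) {ρ : ℕ → V} (hρ : G.IsPlay ρ) {i : ℕ}
    (hp : G.owner (ρ i) = p) : act τ (initialSegment ρ i) =
      τ.1 ⟨initialSegment ρ i, ⟨ρ, hρ, i, rfl⟩, ρ i, initialSegment_getLast? ρ i, hp⟩ :=
  dif_pos (⟨⟨ρ, hρ, i, rfl⟩, ρ i, initialSegment_getLast? ρ i, hp⟩ : _ ∧ _)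

theorem generates_iff {σ : G.Profile} {ρ : G.Play} : G.Generates σ ρ ↔
    ∀ i, ρ.1 (i + 1) = act (σ (G.owner (ρ.1 i))) (initialSegment ρ.1 i) := by
  refine forall_congr' fun i => ?_
  rw [act_initialSegment _ ρ.2 rfl]
  rfl

theorem out_succ (σ : G.Profile) (i : ℕ) : (G.out σ).1 (i + 1) =
    act (σ (G.owner ((G.out σ).1 i))) (initialSegment (G.out σ).1 i) :=
  generates_iff.1 (generates_out σ) i

/-- Every function on lists of vertices yields a strategy, which obeys it wherever this is
possible. -/
theorem exists_strategy (G : GameArena P V) (p : P) (f : List V → V) :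
    ∃ τ : G.Strategy p, ∀ (ρ : ℕ → V), G.IsPlay ρ → ∀ i, G.owner (ρ i) = p →
      G.E (ρ i) (f (initialSegment ρ i)) →
      act τ (initialSegment ρ i) = f (initialSegment ρ i) := by
  classical
  have hex : ∀ h : G.HistOf p, ∃ w, ∀ v, h.1.getLast? = some v →
      G.E v w ∧ (G.E v (f h.1) → w = f h.1) := by
    rintro ⟨h, ⟨ρ, hρ, i, rfl⟩, v, hv, hp⟩
    simp only [hv, Option.some.injEq, forall_eq']
    by_cases hf : G.E v (f (initialSegment ρ i))
    · exact ⟨_, hf, fun _ => rfl⟩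
    · rw [initialSegment_getLast?, Option.some.injEq] at hv
      exact ⟨_, hv ▸ hρ.2 i, fun h => absurd h hf⟩
  choose τ hτ using hex
  refine ⟨⟨τ, fun h v hv => (hτ h v hv).1⟩, fun ρ hρ i hp hE => ?_⟩
  exact (act_initialSegment _ hρ hp).trans ((hτ _ _ (initialSegment_getLast? ρ i)).2 hE)

theorem deviate_self (σ : G.Profile) (p : P) (τ : G.Strategy p) : σ.deviate p τ p = τ := by
  classical exact Function.update_self ..

theorem deviate_of_ne (σ : G.Profile) {p q : P} (τ : G.Strategy p) (h : q ≠ p) :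
    σ.deviate p τ q = σ q := by
  classical exact Function.update_of_ne h ..

theorem initialSegment_congr {ρ ρ' : ℕ → V} {k : ℕ} (h : ∀ i ≤ k, ρ i = ρ' i) :
    initialSegment ρ k = initialSegment ρ' k :=
  List.map_congr_left fun i hi => h i (by simpa [Nat.lt_succ_iff] using hi)

/-- A play is the outcome of an equilibrium if, from each of its vertices and against each player,
the others can prevent all plays by which this player would improve upon it: they punish the
first player who leaves the play. -/
theorem exists_isMultiNash {n : ℕ} {F : Fin n → P → Set (Set V)} {E : V → V → Prop}
    (hE : ∀ v, Relation.ReflTransGen G.E G.init v → ∀ w, E v w ↔ G.E v w) (ρ : G.Play)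
    (h : ∀ p i, Forces E {v | G.owner v ≠ p} (improving F p (G.Inf ρ))ᶜ Set.univ ∅ (ρ.1 i)) :
    ∃ σ : G.Profile, G.IsMultiNash σ fun j p => G.Muller (F j p) := by
  classical
  choose X hX lab R hG x₀ hx₀ using h
  choose next move hnext hmove using fun p i => (hG p i).exists_next_move
  -- The memory: the number of the step while everyone conforms, afterwards the deviating player,
  -- the time of her deviation and a node of the corresponding graph.
  obtain ⟨mem, hmem⟩ := exists_memory (S := ℕ ⊕ Σ a : P × ℕ, X a.1 a.2) (.inl 0) fun s w =>
    match s with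
    | .inl k => if w = ρ.1 (k + 1) then .inl (k + 1) else
        .inr ⟨(G.owner (ρ.1 k), k), next _ _ (x₀ _ _) w⟩
    | .inr ⟨a, x⟩ => .inr ⟨a, next _ _ x w⟩
  let f : List V → V := fun h => match mem h with
    | .inl k => ρ.1 (k + 1)
    | .inr ⟨a, x⟩ => lab _ _ (move _ _ x)
  obtain ⟨σ, hσ⟩ : ∃ σ : G.Profile, ∀ q, ∀ ρ' : ℕ → V, G.IsPlay ρ' → ∀ i, G.owner (ρ' i) = q →
      G.E (ρ' i) (f (initialSegment ρ' i)) →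
      act (σ q) (initialSegment ρ' i) = f (initialSegment ρ' i) :=
    Classical.axiom_of_choice fun q => G.exists_strategy q f
  have hon : ∀ (ρ' : ℕ → V) k, (∀ i ≤ k, ρ' i = ρ.1 i) → mem (initialSegment ρ' k) = .inl k := by
    intro ρ' k
    induction k with
    | zero => exact fun _ => (hmem ρ').1
    | succ k ih =>
      intro hk
      rw [(hmem ρ').2, ih fun i hi => hk i (by omega)]
      simp only [hk (k + 1) le_rfl, if_true]
  have hfon : ∀ (ρ' : ℕ → V) k, (∀ i ≤ k, ρ' i = ρ.1 i) →
      f (initialSegment ρ' k) = ρ.1 (k + 1) := by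
    intro ρ' k hk
    simp only [f, hon ρ' k hk]
  have hout : G.out σ = ρ := by
    refine out_eq (generates_iff.2 fun i => ?_)
    have hf := hfon ρ.1 i fun _ _ => rfl
    rw [hσ _ ρ.1 ρ.2 i rfl (by rw [hf]; exact ρ.2.2 i), hf]
  refine ⟨σ, fun j p τ hwin => ?_⟩
  change G.Inf (G.out (σ.deviate p τ)) ∈ F j p at hwin
  change G.Inf (G.out σ) ∈ F j p
  rw [hout]
  set ρ' := G.out (σ.deviate p τ) with hρ'
  have hother : ∀ k, G.owner (ρ'.1 k) ≠ p → G.E (ρ'.1 k) (f (initialSegment ρ'.1 k)) →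
      ρ'.1 (k + 1) = f (initialSegment ρ'.1 k) := by
    intro k hk hf
    rw [hρ', out_succ, ← hρ', deviate_of_ne _ _ hk]
    exact hσ _ ρ'.1 ρ'.2 k rfl hf
  by_cases hsame : ∀ k, ρ'.1 k = ρ.1 k
  · have : ρ' = ρ := Subtype.ext (funext hsame)
    rwa [← this]
  push Not at hsame
  have hmin : ∃ k, (∀ i ≤ k, ρ'.1 i = ρ.1 i) ∧ ρ'.1 (k + 1) ≠ ρ.1 (k + 1) := by
    obtain ⟨k, hk⟩ : ∃ k, Nat.find hsame = k + 1 := by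
      refine Nat.exists_eq_succ_of_ne_zero fun h0 => Nat.find_spec hsame ?_
      rw [h0, ρ'.2.1, ρ.2.1]
    refine ⟨k, fun i hi => ?_, hk ▸ Nat.find_spec hsame⟩
    simpa using Nat.find_min hsame (show i < Nat.find hsame by omega)
  obtain ⟨k, hk, hne⟩ := hmin
  have hp : G.owner (ρ.1 k) = p := by
    by_contra hcon
    refine hne ((hother k (hk k le_rfl ▸ hcon) ?_).trans (hfon _ k hk))
    rw [hfon _ k hk, hk k le_rfl]
    exact ρ.2.2 k
  let s : ℕ → X p k := fun m => Nat.rec (x₀ p k) (fun m x => next p k x (ρ'.1 (k + m + 1))) m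
  have hs : ∀ m, mem (initialSegment ρ'.1 (k + (m + 1))) = .inr ⟨(p, k), s (m + 1)⟩ := by
    intro m
    induction m with
    | zero =>
      rw [show k + (0 + 1) = k + 1 from rfl, (hmem _).2, hon _ k hk]
      simp only [hne, if_false]
      subst hp
      rfl
    | succ m ih =>
      rw [show k + (m + 1 + 1) = k + (m + 1) + 1 from rfl, (hmem _).2, ih]
  have hwin' := (hG p k).follow (hnext p k) (hmove p k) (ρ := ρ'.1) (i := k)
    (fun m => (hE _ (ρ'.2.reachable _) _).2 (ρ'.2.2 _)) s
    ((hx₀ p k).trans (hk k le_rfl).symm) (fun m => rfl) fun m hlab hO => by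
      cases m with
      | zero => exact absurd ((congrArg G.owner (hk k le_rfl)).trans hp) hO
      | succ m =>
        have hf : f (initialSegment ρ'.1 (k + (m + 1))) = lab p k (move p k (s (m + 1))) := by
          simp only [f, hs m]
        rw [← hf]
        refine hother _ hO ?_
        rw [hf, ← hE _ (ρ'.2.reachable _), ← hlab]
        exact (hG p k).edge _ _ (hmove p k _ (by rw [hlab]; exact hO))
  by_contra hcon
  exact hwin' ⟨j, hcon, hwin⟩

/-- Along the outcome of an equilibrium no player can force a play by which she would improve. -/
theorem IsMultiNash.not_forces {n : ℕ} {F : Fin n → P → Set (Set V)} {E : V → V → Prop}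
    (hE : ∀ v, Relation.ReflTransGen G.E G.init v → ∀ w, E v w ↔ G.E v w) {σ : G.Profile}
    (hσ : G.IsMultiNash σ fun j p => G.Muller (F j p)) (p : P) (i : ℕ) :
    ¬ Forces E {v | G.owner v = p} (improving F p (G.Inf (G.out σ))) Set.univ ∅
      ((G.out σ).1 i) := by
  classical
  rintro ⟨X, hX, lab, R, hG, x₀, hx₀⟩
  obtain ⟨next, move, hnext, hmove⟩ := hG.exists_next_move
  set ρ := G.out σ with hρ
  -- The player conforms until time `i` and follows the strategy graph afterwards.
  obtain ⟨mem, hmem⟩ := exists_memory (S := ℕ ⊕ X) (if 0 < i then .inl 0 else .inr x₀) fun s w =>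
    match s with
    | .inl k => if k + 1 < i then .inl (k + 1) else .inr x₀
    | .inr x => .inr (next x w)
  let f : List V → V := fun h => match mem h with
    | .inl k => ρ.1 (k + 1)
    | .inr x => lab (move x)
  obtain ⟨τ, hτ⟩ := G.exists_strategy p f
  set ρ' := G.out (σ.deviate p τ) with hρ'
  have hbefore : ∀ k < i, mem (initialSegment ρ'.1 k) = .inl k := by
    intro k
    induction k with
    | zero =>
      intro h
      rw [(hmem _).1, if_pos h]
    | succ k ih =>
      intro h
      rw [(hmem _).2, ih (by omega)]
      simp only [h, if_true]
  have hat : mem (initialSegment ρ'.1 i) = .inr x₀ := by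
    cases i with
    | zero => exact (hmem _).1
    | succ i =>
      rw [(hmem _).2, hbefore i (by omega)]
      simp
  have hself : ∀ k, G.owner (ρ'.1 k) = p → G.E (ρ'.1 k) (f (initialSegment ρ'.1 k)) →
      ρ'.1 (k + 1) = f (initialSegment ρ'.1 k) := by
    intro k hk hf
    rw [hρ', out_succ, ← hρ', hk, deviate_self]
    exact hτ ρ'.1 ρ'.2 k hk hf
  have hsame : ∀ k ≤ i, ∀ l ≤ k, ρ'.1 l = ρ.1 l := by
    intro k
    induction k with
    | zero =>
      rintro - l hl
      obtain rfl : l = 0 := by omega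
      rw [ρ'.2.1, ρ.2.1]
    | succ k ih =>
      intro hk l hl
      obtain hl | rfl := Nat.le_succ_iff.1 hl
      · exact ih (by omega) l hl
      have hk' := ih (by omega)
      by_cases ho : G.owner (ρ'.1 k) = p
      · have hf : f (initialSegment ρ'.1 k) = ρ.1 (k + 1) := by
          simp only [f, hbefore k (by omega)]
        rw [hself k ho (by rw [hf, hk' k le_rfl]; exact ρ.2.2 k), hf]
      · rw [hρ', out_succ, ← hρ', deviate_of_ne _ _ ho, hk' k le_rfl, initialSegment_congr hk',
          hρ, out_succ]
  let s : ℕ → X := fun m => Nat.rec x₀ (fun m x => next x (ρ'.1 (i + m + 1))) m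
  have hs : ∀ m, mem (initialSegment ρ'.1 (i + m)) = .inr (s m) := by
    intro m
    induction m with
    | zero => exact hat
    | succ m ih => rw [← add_assoc, (hmem _).2, ih]
  obtain ⟨j, hj, hj'⟩ := hG.follow hnext hmove (ρ := ρ'.1) (i := i)
    (fun m => (hE _ (ρ'.2.reachable _) _).2 (ρ'.2.2 _)) s
    (hx₀.trans (hsame i le_rfl i le_rfl).symm) (fun m => rfl) fun m hlab hO => by
      have hf : f (initialSegment ρ'.1 (i + m)) = lab (move (s m)) := by
        simp only [f, hs m]
      rw [← hf]
      refine hself _ hO ?_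
      rw [hf, ← hE _ (ρ'.2.reachable _), ← hlab]
      exact hG.edge _ _ (hmove _ (by rw [hlab]; exact hO))
  exact hj (hσ j p τ hj')

end GameArena

/-! ### Primitive recursive predicates -/

section Primrec

-- Lets `fun_prop` discharge the goals about projections from nested contexts of quantifiers.
attribute [fun_prop] Primrec
attribute [fun_prop] Primrec.id Primrec.const Primrec.comp Primrec.fst Primrec.snd Primrec.pair

variable {α β : Type*} [Primcodable α] [Primcodable β]

theorem PrimrecPred.imp {p q : α → Prop} (hp : PrimrecPred p) (hq : PrimrecPred q) :
    PrimrecPred fun a => p a → q a :=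
  (hp.not.or hq).of_eq fun _ => imp_iff_not_or.symm

theorem PrimrecPred.iff {p q : α → Prop} (hp : PrimrecPred p) (hq : PrimrecPred q) :
    PrimrecPred fun a => (p a ↔ q a) :=
  ((hp.imp hq).and (hq.imp hp)).of_eq fun _ => iff_iff_implies_and_implies.symm

theorem PrimrecPred.eq_of {f g : α → β} (hf : Primrec f) (hg : Primrec g) :
    PrimrecPred fun a => f a = g a :=
  Primrec.eq.comp hf hg

theorem PrimrecPred.lt_of {f g : α → ℕ} (hf : Primrec f) (hg : Primrec g) :
    PrimrecPred fun a => f a < g a :=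
  Primrec.nat_lt.comp hf hg

theorem PrimrecPred.exists_mem {l : α → List β} {p : α → β → Prop} (hl : Primrec l)
    (hp : PrimrecPred fun a : α × β => p a.1 a.2) : PrimrecPred fun a => ∃ x ∈ l a, p a x :=
  (PrimrecRel.exists_mem_list (R := fun x a => p a x)
    (hp.comp (Primrec.pair Primrec.snd Primrec.fst))).comp hl Primrec.id

theorem PrimrecPred.forall_mem {l : α → List β} {p : α → β → Prop} (hl : Primrec l)
    (hp : PrimrecPred fun a : α × β => p a.1 a.2) : PrimrecPred fun a => ∀ x ∈ l a, p a x :=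
  (PrimrecRel.forall_mem_list (R := fun x a => p a x)
    (hp.comp (Primrec.pair Primrec.snd Primrec.fst))).comp hl Primrec.id

theorem PrimrecPred.exists_lt_of {f : α → ℕ} {p : α → ℕ → Prop} (hf : Primrec f)
    (hp : PrimrecPred fun a : α × ℕ => p a.1 a.2) : PrimrecPred fun a => ∃ x < f a, p a x :=
  (PrimrecPred.exists_mem (Primrec.list_range.comp hf) hp).of_eq fun _ => by simp

theorem PrimrecPred.forall_lt_of {f : α → ℕ} {p : α → ℕ → Prop} (hf : Primrec f)
    (hp : PrimrecPred fun a : α × ℕ => p a.1 a.2) : PrimrecPred fun a => ∀ x < f a, p a x :=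
  (PrimrecPred.forall_mem (Primrec.list_range.comp hf) hp).of_eq fun _ => by simp

theorem PrimrecPred.list_mem {f : α → β} {l : α → List β} (hf : Primrec f) (hl : Primrec l) :
    PrimrecPred fun a => f a ∈ l a :=
  (PrimrecPred.exists_mem (p := fun a x => x = f a) hl
    (Primrec.eq.comp Primrec.snd (hf.comp Primrec.fst))).of_eq fun _ => by simp

@[fun_prop]
theorem Primrec.nat_two_pow {f : α → ℕ} (hf : Primrec f) : Primrec fun a => 2 ^ f a :=
  (Primrec₂.unpaired'.1 Nat.Primrec.pow).comp (Primrec.const 2) hf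

theorem PrimrecPred.nat_testBit {f g : α → ℕ} (hf : Primrec f) (hg : Primrec g) :
    PrimrecPred fun a => (f a).testBit (g a) = true :=
  (Primrec.eq.comp (Primrec.nat_mod.comp (Primrec.nat_div.comp hf (Primrec.nat_two_pow hg))
    (Primrec.const 2)) (Primrec.const 1)).of_eq fun _ => by
      rw [Nat.testBit_eq_decide_div_mod_eq, decide_eq_true_iff]

/-- If every `a` is related to some `b` by a decidable relation, then such a `b` can be found by
unbounded search. -/
theorem exists_computable_of_forall_exists {R : α → β → Prop} (hR : PrimrecRel R)
    (h : ∀ a, ∃ b, R a b) : ∃ f : α → β, Computable f ∧ ∀ a, R a (f a) := by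
  classical
  let g : α → ℕ → Option β := fun a n => (Encodable.decode (α := β) n).bind fun b =>
    if R a b then some b else none
  have hg : Computable₂ g := by
    refine Primrec.to_comp (Primrec.option_bind (Primrec.decode.comp Primrec.snd) ?_)
    exact Primrec.ite (hR.comp (Primrec.fst.comp Primrec.fst) Primrec.snd)
      (Primrec.option_some.comp Primrec.snd) (Primrec.const none)
  have hdom : ∀ a, (Nat.rfindOpt (g a)).Dom := fun a => by
    obtain ⟨b, hb⟩ := h a
    exact Nat.rfindOpt_dom.2 ⟨Encodable.encode b, b, by simp [g, hb]⟩
  refine ⟨fun a => (Nat.rfindOpt (g a)).get (hdom a), ?_, fun a => ?_⟩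
  · exact (Partrec.rfindOpt hg).of_eq fun a => (Part.some_get (hdom a)).symm
  · obtain ⟨n, hn⟩ := Nat.rfindOpt_spec (Part.get_mem (hdom a))
    simp only [g, Option.mem_def, Option.bind_eq_some_iff] at hn
    obtain ⟨b, -, hb⟩ := hn
    split_ifs at hb with h'
    rw [Option.some.injEq] at hb
    subst hb
    exact h'

theorem PrimrecRel.computablePred_comp {R : α → β → Prop} (hR : PrimrecRel R) {f : α → β}
    (hf : Computable f) : ComputablePred fun a => R a (f a) := by
  classical
  exact ⟨inferInstance, hR.decide.to_comp.comp Computable.id hf⟩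

@[fun_prop]
theorem Primrec.list_getD_of (d : β) {l : α → List β} {f : α → ℕ} (hl : Primrec l)
    (hf : Primrec f) : Primrec fun a => (l a).getD (f a) d :=
  (Primrec.list_getD d).comp hl hf

@[fun_prop]
theorem Primrec.list_length_of {l : α → List β} (hl : Primrec l) :
    Primrec fun a => (l a).length :=
  Primrec.list_length.comp hl

end Primrec

/-! ### Strongly connected sets as bit masks -/

/-- The set of numbers `x < k` with the bit mask `m`. -/
def bitSet (k m : ℕ) : Set (Fin k) := {x | m.testBit x = true}

theorem mem_bitSet {k m : ℕ} {x : Fin k} : x ∈ bitSet k m ↔ m.testBit x = true := Iff.rfl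

theorem exists_bitSet_eq {k : ℕ} (S : Set (Fin k)) : ∃ m < 2 ^ k, bitSet k m = S := by
  classical
  refine ⟨Nat.ofBits fun x => decide (x ∈ S), Nat.ofBits_lt_two_pow _, ?_⟩
  ext x
  simp [mem_bitSet]

theorem forall_set_iff {k : ℕ} {p : Set (Fin k) → Prop} :
    (∀ S, p S) ↔ ∀ m < 2 ^ k, p (bitSet k m) := by
  refine ⟨fun h m _ => h _, fun h S => ?_⟩
  obtain ⟨m, hm, rfl⟩ := exists_bitSet_eq S
  exact h m hm

/-- `IsRecurrent` on the vertices below `k`, for bit masks. -/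
def RecurrentMask (k : ℕ) (R : ℕ → ℕ → Prop) (Y : ℕ) : Prop :=
  (∃ x < k, Y.testBit x = true) ∧ ∀ x < k, Y.testBit x = true → ∀ y < k, Y.testBit y = true →
    ∀ Z < 2 ^ k, (∀ z < k, Y.testBit z = true → R x z → Z.testBit z = true) →
      (∀ z < k, Z.testBit z = true → ∀ w < k, Y.testBit w = true → R z w → Z.testBit w = true) →
      Z.testBit y = true

theorem recurrentMask_iff {k : ℕ} {R : ℕ → ℕ → Prop} {Y : ℕ} :
    RecurrentMask k R Y ↔ IsRecurrent (fun x y : Fin k => R x y) (bitSet k Y) := by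
  simp only [RecurrentMask, IsRecurrent, forall_set_iff, mem_bitSet, Fin.forall_iff,
    Fin.exists_iff, exists_prop]

theorem primrecPred_recurrentMask {α : Type*} [Primcodable α] {k Y : α → ℕ}
    {R : α → ℕ → ℕ → Prop} (hk : Primrec k) (hY : Primrec Y)
    (hR : PrimrecPred fun a : (α × ℕ) × ℕ => R a.1.1 a.1.2 a.2) :
    PrimrecPred fun a => RecurrentMask (k a) (R a) (Y a) := by
  have hR' : ∀ {β : Type _} [Primcodable β] {g : β → α} {x y : β → ℕ}, Primrec g → Primrec x →
      Primrec y → PrimrecPred fun b => R (g b) (x b) (y b) := fun hg hx hy =>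
    hR.comp (Primrec.pair (Primrec.pair hg hx) hy)
  refine .and (.exists_lt_of hk (.nat_testBit ?_ ?_)) (.forall_lt_of hk (.imp (.nat_testBit ?_ ?_)
    (.forall_lt_of ?_ (.imp (.nat_testBit ?_ ?_) (.forall_lt_of ?_ (.imp
      (.forall_lt_of ?_ (.imp (.nat_testBit ?_ ?_) (.imp (hR' ?_ ?_ ?_) (.nat_testBit ?_ ?_))))
      (.imp (.forall_lt_of ?_ (.imp (.nat_testBit ?_ ?_) (.forall_lt_of ?_ (.imp
        (.nat_testBit ?_ ?_) (.imp (hR' ?_ ?_ ?_) (.nat_testBit ?_ ?_))))))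
        (.nat_testBit ?_ ?_))))))))
  all_goals fun_prop

/-! ### The decision procedure -/

namespace GameInput

/-- The edges described by an input, with a loop added at every dead end, so that all games on this
graph are determined.  In an arena dead ends are unreachable, so the loops do not matter. -/
def Edge (c : GameInput) (u v : ℕ) : Prop :=
  (u, v) ∈ c.edges ∨ u = v ∧ ∀ w < c.numVertices, (u, w) ∉ c.edges

/-- The list of sets which describes the objective of player `p` in the profile `j`. -/
def family (c : GameInput) (j p : ℕ) : List (List ℕ) :=
  (c.profiles.getD j []).getD p []

/-- The set with bit mask `m` belongs to the objective of player `p` in the profile `j`. -/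
def InFamily (c : GameInput) (j p m : ℕ) : Prop :=
  ∃ l ∈ c.family j p, ∀ v < c.numVertices, m.testBit v = true ↔ v ∈ l

/-- Player `p` loses some profile when the set with bit mask `I` is visited infinitely often, but
wins it when the set with bit mask `m` is. -/
def Improves (c : GameInput) (p I m : ℕ) : Prop :=
  ∃ j < c.profiles.length, ¬ c.InFamily j p I ∧ c.InFamily j p m

/-- The data of a strategy graph: the list of the labels of its nodes and the list of its edges.
The Boolean says whether the graph belongs to a single player or to the coalition against her. -/
abbrev Certificate : Type := Bool × List ℕ × List (ℕ × ℕ)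

/-- `t` is a strategy graph with a node over `v`, either of the player `p` who wants to improve upon
the set with bit mask `I`, or of the coalition which wants to prevent this.  The nodes are the
positions in the list of labels, so the default value of `getD` is not used there; a vertex without
an entry in `c.owner` is given to player `0`, which does not occur in the input of an arena.  The
last condition says that all infinite paths are won: the sets of nodes that they visit infinitely
often are the strongly connected ones. -/
def IsCertificate (c : GameInput) (p I v : ℕ) (t : Certificate) : Prop :=
  (∃ x < t.2.1.length, t.2.1.getD x 0 = v) ∧
  (∀ x < t.2.1.length, t.2.1.getD x 0 < c.numVertices) ∧
  (∀ x < t.2.1.length, ∀ y < t.2.1.length, (x, y) ∈ t.2.2 →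
    c.Edge (t.2.1.getD x 0) (t.2.1.getD y 0)) ∧
  (∀ x < t.2.1.length, (c.owner.getD (t.2.1.getD x 0) 0 = p ↔ t.1 = true) →
    ∃ y < t.2.1.length, (x, y) ∈ t.2.2) ∧
  (∀ x < t.2.1.length, ¬ (c.owner.getD (t.2.1.getD x 0) 0 = p ↔ t.1 = true) →
    ∀ w < c.numVertices, c.Edge (t.2.1.getD x 0) w →
      ∃ y < t.2.1.length, (x, y) ∈ t.2.2 ∧ t.2.1.getD y 0 = w) ∧
  (∀ Y < 2 ^ t.2.1.length, RecurrentMask t.2.1.length (fun x y => (x, y) ∈ t.2.2) Y →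
    ∀ m < 2 ^ c.numVertices, (∀ v < c.numVertices, m.testBit v = true ↔
      ∃ x < t.2.1.length, Y.testBit x = true ∧ t.2.1.getD x 0 = v) →
        (c.Improves p I m ↔ t.1 = true))

/-- `T` contains certificates which decide all games that matter for `c`. -/
def IsComplete (c : GameInput) (T : List Certificate) : Prop :=
  ∀ p < c.numPlayers, ∀ I < 2 ^ c.numVertices, ∀ v < c.numVertices, ∃ t ∈ T,
    c.IsCertificate p I v t

/-- There are sets `I` and `r` of vertices and a play in `r` which visits exactly the vertices of
`I` infinitely often, such that by the certificates in `T` no player can force an improvement upon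
`I` from a vertex in `r`. -/
def HasEquilibrium (c : GameInput) (T : List Certificate) : Prop :=
  ∃ I < 2 ^ c.numVertices, ∃ r < 2 ^ c.numVertices, c.init < c.numVertices ∧
    r.testBit c.init = true ∧
    RecurrentMask c.numVertices (fun u v => c.Edge u v ∧ r.testBit v = true) I ∧
    (∀ Z < 2 ^ c.numVertices, Z.testBit c.init = true →
      (∀ z < c.numVertices, Z.testBit z = true → ∀ w < c.numVertices,
        c.Edge z w ∧ r.testBit w = true → Z.testBit w = true) →
      ∃ y < c.numVertices, I.testBit y = true ∧ Z.testBit y = true) ∧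
    ∀ v < c.numVertices, r.testBit v = true → ∀ p < c.numPlayers, ∃ t ∈ T,
      t.1 = false ∧ c.IsCertificate p I v t

section Primrec

variable {α : Type*} [Primcodable α]

theorem primrec_equivProd : Primrec equivProd := Primrec.of_equiv

@[fun_prop]
theorem primrec_numPlayers : Primrec numPlayers :=
  Primrec.fst.comp primrec_equivProd

@[fun_prop]
theorem primrec_numVertices : Primrec numVertices :=
  (Primrec.fst.comp Primrec.snd).comp primrec_equivProd

@[fun_prop]
theorem primrec_owner : Primrec owner :=
  (Primrec.fst.comp (Primrec.snd.comp Primrec.snd)).comp primrec_equivProd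

@[fun_prop]
theorem primrec_init : Primrec init :=
  (Primrec.fst.comp (Primrec.snd.comp (Primrec.snd.comp Primrec.snd))).comp primrec_equivProd

@[fun_prop]
theorem primrec_edges : Primrec edges :=
  (Primrec.fst.comp (Primrec.snd.comp (Primrec.snd.comp (Primrec.snd.comp Primrec.snd)))).comp
    primrec_equivProd

@[fun_prop]
theorem primrec_profiles : Primrec profiles :=
  (Primrec.snd.comp (Primrec.snd.comp (Primrec.snd.comp (Primrec.snd.comp Primrec.snd)))).comp
    primrec_equivProd

theorem primrecPred_edge {c : α → GameInput} {u v : α → ℕ} (hc : Primrec c) (hu : Primrec u)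
    (hv : Primrec v) : PrimrecPred fun a => (c a).Edge (u a) (v a) := by
  refine .or (.list_mem ?_ ?_) (.and (.eq_of ?_ ?_) (.forall_lt_of ?_ (.not (.list_mem ?_ ?_))))
  all_goals fun_prop

theorem primrecPred_inFamily {c : α → GameInput} {j p m : α → ℕ} (hc : Primrec c)
    (hj : Primrec j) (hp : Primrec p) (hm : Primrec m) :
    PrimrecPred fun a => (c a).InFamily (j a) (p a) (m a) := by
  unfold InFamily family
  refine .exists_mem ?_ (.forall_lt_of ?_ (.iff (.nat_testBit ?_ ?_) (.list_mem ?_ ?_)))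
  all_goals fun_prop

theorem primrecPred_improves {c : α → GameInput} {p I m : α → ℕ} (hc : Primrec c)
    (hp : Primrec p) (hI : Primrec I) (hm : Primrec m) :
    PrimrecPred fun a => (c a).Improves (p a) (I a) (m a) := by
  refine .exists_lt_of ?_ (.and (.not (primrecPred_inFamily ?_ ?_ ?_ ?_))
    (primrecPred_inFamily ?_ ?_ ?_ ?_))
  all_goals fun_prop

theorem primrecPred_isCertificate {c : α → GameInput} {p I v : α → ℕ} {t : α → Certificate}
    (hc : Primrec c) (hp : Primrec p) (hI : Primrec I) (hv : Primrec v) (ht : Primrec t) :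
    PrimrecPred fun a => (c a).IsCertificate (p a) (I a) (v a) (t a) := by
  refine .and (.exists_lt_of ?_ (.eq_of ?_ ?_)) (.and (.forall_lt_of ?_ (.lt_of ?_ ?_))
    (.and (.forall_lt_of ?_ (.forall_lt_of ?_ (.imp (.list_mem ?_ ?_) (primrecPred_edge ?_ ?_ ?_))))
    (.and (.forall_lt_of ?_ (.imp (.iff (.eq_of ?_ ?_) (.eq_of ?_ ?_))
      (.exists_lt_of ?_ (.list_mem ?_ ?_))))
    (.and (.forall_lt_of ?_ (.imp (.not (.iff (.eq_of ?_ ?_) (.eq_of ?_ ?_)))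
      (.forall_lt_of ?_ (.imp (primrecPred_edge ?_ ?_ ?_) (.exists_lt_of ?_
        (.and (.list_mem ?_ ?_) (.eq_of ?_ ?_)))))))
    (.forall_lt_of ?_ (.imp (primrecPred_recurrentMask ?_ ?_ (.list_mem ?_ ?_)) (.forall_lt_of ?_
      (.imp (.forall_lt_of ?_ (.iff (.nat_testBit ?_ ?_) (.exists_lt_of ?_ (.and (.nat_testBit ?_ ?_)
        (.eq_of ?_ ?_))))) (.iff (primrecPred_improves ?_ ?_ ?_ ?_) (.eq_of ?_ ?_))))))))))
  all_goals fun_prop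

theorem primrecRel_isComplete : PrimrecRel IsComplete := by
  refine .forall_lt_of ?_ (.forall_lt_of ?_ (.forall_lt_of ?_ (.exists_mem ?_
    (primrecPred_isCertificate ?_ ?_ ?_ ?_ ?_))))
  all_goals fun_prop

theorem primrecRel_hasEquilibrium : PrimrecRel HasEquilibrium := by
  refine .exists_lt_of ?_ (.exists_lt_of ?_ (.and (.lt_of ?_ ?_) (.and (.nat_testBit ?_ ?_)
    (.and (primrecPred_recurrentMask ?_ ?_ (.and (primrecPred_edge ?_ ?_ ?_) (.nat_testBit ?_ ?_)))
    (.and (.forall_lt_of ?_ (.imp (.nat_testBit ?_ ?_) (.imp (.forall_lt_of ?_ (.imp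
      (.nat_testBit ?_ ?_) (.forall_lt_of ?_ (.imp (.and (primrecPred_edge ?_ ?_ ?_)
      (.nat_testBit ?_ ?_)) (.nat_testBit ?_ ?_))))) (.exists_lt_of ?_ (.and (.nat_testBit ?_ ?_)
      (.nat_testBit ?_ ?_))))))
    (.forall_lt_of ?_ (.imp (.nat_testBit ?_ ?_) (.forall_lt_of ?_ (.exists_mem ?_
      (.and (.eq_of ?_ ?_) (primrecPred_isCertificate ?_ ?_ ?_ ?_ ?_)))))))))))
  all_goals fun_prop

end Primrec

end GameInput

/-! ### Correctness of the decision procedure -/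

namespace GameInput

/-- The Muller families described by an input. -/
def families (c : GameInput) (j : Fin c.profiles.length) (p : ℕ) : Set (Set (Fin c.numVertices)) :=
  {S | ∃ l ∈ c.family j p, ∀ v, v ∈ S ↔ v.val ∈ l}

theorem improves_iff {c : GameInput} {p I m : ℕ} : c.Improves p I m ↔
    bitSet c.numVertices m ∈ improving c.families p (bitSet c.numVertices I) := by
  simp only [Improves, improving, InFamily, families, Set.mem_ofPred_eq, mem_bitSet,
    Fin.forall_iff, Fin.exists_iff, exists_prop]

/-- The vertices of player `p` (for `b = true`) or of the other players (for `b = false`). -/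
def side (c : GameInput) (p : ℕ) (b : Bool) : Set (Fin c.numVertices) :=
  {v | c.owner.getD v 0 = p ↔ b = true}

/-- The aim of player `p` (for `b = true`) or of the other players (for `b = false`) in the game
on whether `p` improves upon `I`. -/
def aim (c : GameInput) (p : ℕ) (I : Set (Fin c.numVertices)) (b : Bool) :
    Set (Set (Fin c.numVertices)) :=
  {S | S ∈ improving c.families p I ↔ b = true}

theorem side_false (c : GameInput) (p : ℕ) : c.side p false = (c.side p true)ᶜ := by
  ext v
  simp [side]

theorem aim_false (c : GameInput) (p : ℕ) (I : Set (Fin c.numVertices)) :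
    c.aim p I false = (c.aim p I true)ᶜ := by
  ext v
  simp [aim]

theorem IsCertificate.forces {c : GameInput} {p I : ℕ} {v : Fin c.numVertices} {t : Certificate}
    (h : c.IsCertificate p I v t) :
    Forces (fun u v : Fin c.numVertices => c.Edge u v) (c.side p t.1)
      (c.aim p (bitSet c.numVertices I) t.1) Set.univ ∅ v := by
  obtain ⟨⟨x, hx, hxv⟩, hlt, hedge, hown, hopp, hwin⟩ := h
  refine ⟨Fin t.2.1.length, inferInstance, fun x => ⟨t.2.1.getD x 0, hlt x x.2⟩,
    fun x y => (x.val, y.val) ∈ t.2.2, ⟨fun _ => Set.mem_univ _, ?_, ?_, ?_, ?_⟩,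
    ⟨x, hx⟩, Fin.ext hxv⟩
  · exact fun x y hR => hedge x x.2 y y.2 hR
  · intro x hO _
    obtain ⟨y, hy, hR⟩ := hown x x.2 hO
    exact ⟨⟨y, hy⟩, hR⟩
  · intro x hO _ w _ hE
    obtain ⟨y, hy, hR, hw⟩ := hopp x x.2 hO w w.2 hE
    exact ⟨⟨y, hy⟩, hR, Fin.ext hw⟩
  · intro π hπ
    obtain ⟨Y, hY, hYeq⟩ := exists_bitSet_eq (infSet π)
    have hrec := isRecurrent_infSet (R := fun x y : Fin t.2.1.length => (x.val, y.val) ∈ t.2.2) hπ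
    rw [← hYeq] at hrec
    rw [infSet_comp (fun x : Fin t.2.1.length => (⟨t.2.1.getD x 0, hlt x x.2⟩ : Fin _)), ← hYeq]
    obtain ⟨m, hm, hmeq⟩ := exists_bitSet_eq
      ((fun x : Fin t.2.1.length => (⟨t.2.1.getD x 0, hlt x x.2⟩ : Fin c.numVertices)) ''
        bitSet _ Y)
    rw [← hmeq]
    refine improves_iff.symm.trans (hwin Y hY ?_ m hm fun v hv => ?_)
    · exact recurrentMask_iff.2 hrec
    · have := Set.ext_iff.1 hmeq ⟨v, hv⟩
      rw [mem_bitSet] at this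
      rw [this]
      simp only [Set.mem_image, mem_bitSet, Fin.exists_iff, Fin.mk.injEq, exists_prop]

theorem exists_isCertificate {c : GameInput} {p I : ℕ} {v : Fin c.numVertices} {b : Bool}
    (h : Forces (fun u v : Fin c.numVertices => c.Edge u v) (c.side p b)
      (c.aim p (bitSet c.numVertices I) b) Set.univ ∅ v) :
    ∃ t : Certificate, t.1 = b ∧ c.IsCertificate p I v t := by
  obtain ⟨X, hX, lab, R, hG, x₀, rfl⟩ := h
  obtain ⟨k, ⟨e⟩⟩ := Finite.exists_equiv_fin X
  obtain ⟨es, hes⟩ : ∃ es : List (ℕ × ℕ), ∀ x y : Fin k,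
      (x.val, y.val) ∈ es ↔ R (e.symm x) (e.symm y) := by
    classical
    refine ⟨((Set.toFinite {a : Fin k × Fin k | R (e.symm a.1) (e.symm a.2)}).toFinset.image
      fun a => (a.1.val, a.2.val)).toList, fun x y => ?_⟩
    simp [Fin.val_inj]
  have hlen : (List.ofFn fun i => (lab (e.symm i)).val).length = k := List.length_ofFn
  have hget : ∀ (x : ℕ) (hx : x < k), (List.ofFn fun i => (lab (e.symm i)).val).getD x 0 =
      (lab (e.symm ⟨x, hx⟩)).val := fun x hx => by simp [List.getD, hx]
  refine ⟨(b, List.ofFn fun i => (lab (e.symm i)).val, es), rfl, ?_⟩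
  simp only [IsCertificate, hlen]
  refine ⟨⟨e x₀, (e x₀).2, ?_⟩, ?_, ?_, ?_, ?_, ?_⟩
  · rw [hget _ (e x₀).2]
    simp
  · intro x hx
    rw [hget x hx]
    exact Fin.is_lt _
  · intro x hx y hy hR
    rw [hget x hx, hget y hy]
    exact hG.edge _ _ ((hes ⟨x, hx⟩ ⟨y, hy⟩).1 hR)
  · intro x hx hO
    rw [hget x hx] at hO
    obtain ⟨y, hy⟩ := hG.own (e.symm ⟨x, hx⟩) hO (Set.notMem_empty _)
    exact ⟨e y, (e y).2, (hes ⟨x, hx⟩ (e y)).2 (by simpa using hy)⟩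
  · intro x hx hO w hw hE
    rw [hget x hx] at hO hE
    obtain ⟨y, hy, hyw⟩ := hG.opp (e.symm ⟨x, hx⟩) hO (Set.notMem_empty _) ⟨w, hw⟩
      (Set.mem_univ _) hE
    refine ⟨e y, (e y).2, (hes ⟨x, hx⟩ (e y)).2 (by simpa using hy), ?_⟩
    rw [hget _ (e y).2]
    simp [hyw]
  · intro Y hY hrec m hm hmY
    rw [recurrentMask_iff] at hrec
    obtain ⟨x, hx⟩ := hrec.1
    obtain ⟨π, -, hR, hinf⟩ := hrec.exists_path hx
    have hw := hG.win (fun i => e.symm (π i)) fun i => (hes _ _).1 (hR i)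
    have himg := infSet_comp (fun x : Fin k => lab (e.symm x)) π
    have : infSet (fun i => lab (e.symm (π i))) = bitSet c.numVertices m := by
      rw [himg, hinf]
      ext v
      rw [mem_bitSet, hmY v v.2]
      constructor
      · rintro ⟨x, hx, rfl⟩
        exact ⟨x, x.2, hx, hget x x.2⟩
      · rintro ⟨x, hx, hxY, hxv⟩
        rw [hget x hx] at hxv
        exact ⟨⟨x, hx⟩, hxY, Fin.ext hxv⟩
    rw [improves_iff, ← this]
    exact hw

theorem exists_edge (c : GameInput) (v : Fin c.numVertices) :
    ∃ w : Fin c.numVertices, c.Edge v w := by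
  by_cases h : ∃ w < c.numVertices, (v.val, w) ∈ c.edges
  · obtain ⟨w, hw, h⟩ := h
    exact ⟨⟨w, hw⟩, .inl h⟩
  · push Not at h
    exact ⟨v, .inr ⟨rfl, h⟩⟩

theorem forces_true_or_false (c : GameInput) (p : ℕ) (I : Set (Fin c.numVertices))
    (v : Fin c.numVertices) : ∃ b,
    Forces (fun u v : Fin c.numVertices => c.Edge u v) (c.side p b) (c.aim p I b) Set.univ ∅ v := by
  obtain h | h := forces_or_forces_compl (fun u v : Fin c.numVertices => c.Edge u v)
    (c.side p true) (c.aim p I true) Set.univ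
    (fun v _ => (c.exists_edge v).imp fun _ h => ⟨Set.mem_univ _, h⟩) v (Set.mem_univ _)
  · exact ⟨true, h⟩
  · refine ⟨false, ?_⟩
    rwa [side_false, aim_false]

theorem exists_isComplete (c : GameInput) : ∃ T, c.IsComplete T := by
  have h : ∀ a : Fin c.numPlayers × Fin (2 ^ c.numVertices) × Fin c.numVertices,
      ∃ t, c.IsCertificate a.1 a.2.1 a.2.2 t := by
    intro a
    obtain ⟨b, hb⟩ := c.forces_true_or_false a.1 (bitSet _ a.2.1) a.2.2
    exact (exists_isCertificate hb).imp fun _ h => h.2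
  choose f hf using h
  classical
  refine ⟨(Finset.univ.image f).toList, fun p hp I hI v hv => ⟨f (⟨p, hp⟩, ⟨I, hI⟩, ⟨v, hv⟩), ?_, ?_⟩⟩
  · simp
  · exact hf (⟨p, hp⟩, ⟨I, hI⟩, ⟨v, hv⟩)

/-- The bounded condition `HasEquilibrium` speaks about the existence of an infinite play. -/
theorem hasEquilibrium_iff {c : GameInput} {T : List Certificate} : c.HasEquilibrium T ↔
    ∃ I < 2 ^ c.numVertices, ∃ π : ℕ → Fin c.numVertices, (π 0).val = c.init ∧
      (∀ i, c.Edge (π i) (π (i + 1))) ∧ infSet π = bitSet c.numVertices I ∧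
      ∀ i, ∀ p < c.numPlayers, ∃ t ∈ T, t.1 = false ∧ c.IsCertificate p I (π i) t := by
  refine exists_congr fun I => and_congr_right fun _ => ?_
  constructor
  · rintro ⟨r, -, hinit, hr0, hrec, hreach, hr⟩
    obtain ⟨π, h0, hR, hinf⟩ := (exists_path_infSet_eq_iff (a := (⟨c.init, hinit⟩ : Fin _))
      (R := fun u v : Fin c.numVertices => c.Edge u v ∧ r.testBit v = true)).2
      ⟨recurrentMask_iff.1 hrec, by
        simpa only [forall_set_iff, mem_bitSet, Fin.forall_iff, Fin.exists_iff, exists_prop]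
          using hreach⟩
    refine ⟨π, by rw [h0], fun i => (hR i).1, hinf, fun i => hr _ (π i).2 ?_⟩
    cases i with
    | zero => rwa [h0]
    | succ i => exact (hR i).2
  · rintro ⟨π, h0, hR, hinf, hT⟩
    obtain ⟨r, hr, hreq⟩ := exists_bitSet_eq (Set.range π)
    have hmem : ∀ i, r.testBit (π i) = true := fun i => by
      rw [← mem_bitSet, hreq]
      exact ⟨i, rfl⟩
    obtain ⟨hrec, hreach⟩ := (exists_path_infSet_eq_iff (a := π 0)
      (R := fun u v : Fin c.numVertices => c.Edge u v ∧ r.testBit v = true)).1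
      ⟨π, rfl, fun i => ⟨hR i, hmem _⟩, hinf⟩
    refine ⟨r, hr, h0 ▸ (π 0).2, h0 ▸ hmem 0, recurrentMask_iff.2 hrec, ?_, ?_⟩
    · simpa only [forall_set_iff, mem_bitSet, Fin.forall_iff, Fin.exists_iff, exists_prop, h0]
          using hreach
    · intro v hv hrv
      have : (⟨v, hv⟩ : Fin c.numVertices) ∈ bitSet _ r := hrv
      rw [hreq] at this
      obtain ⟨i, hi⟩ := this
      have hi' : (π i).val = v := congrArg Fin.val hi
      exact hi' ▸ hT i

end GameInput

theorem Forces.of_equiv {V W : Type*} (e : V ≃ W) {E : W → W → Prop} {O : Set W}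
    {F : Set (Set W)} {v : V} (h : Forces E O F Set.univ ∅ (e v)) :
    Forces (fun u v => E (e u) (e v)) (e ⁻¹' O) {S | e.symm ⁻¹' S ∈ F} Set.univ ∅ v := by
  obtain ⟨X, hX, lab, R, hG, x, hx⟩ := h
  refine ⟨X, hX, fun x => e.symm (lab x), R, ⟨fun _ => Set.mem_univ _, ?_, ?_, ?_, ?_⟩, x,
    by simp [hx]⟩
  · intro x y hR
    simpa using hG.edge x y hR
  · intro x hO _
    exact hG.own x (by simpa using hO) (Set.notMem_empty _)
  · intro x hO _ w _ hE
    obtain ⟨y, hy, hw⟩ := hG.opp x (by simpa using hO) (Set.notMem_empty _) (e w)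
      (Set.mem_univ _) (by simpa using hE)
    exact ⟨y, hy, by simp [hw]⟩
  · intro π hπ
    change e.symm ⁻¹' infSet _ ∈ F
    rw [← infSet_comp_equiv]
    simpa using hG.win π hπ

namespace GameInput.Encodes

variable {P V : Type*} {n : ℕ} {c : GameInput} {eP : P ≃ Fin c.numPlayers}
  {eV : V ≃ Fin c.numVertices} {G : GameArena P V} {F : Fin n → P → Set (Set V)}

theorem edge_iff (h : c.Encodes eP eV G F) (v : V) (hv : Relation.ReflTransGen G.E G.init v)
    (w : V) : c.Edge (eV v) (eV w) ↔ G.E v w := by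
  rw [h.edges]
  refine ⟨fun hE => hE.resolve_right fun ⟨_, hd⟩ => ?_, .inl⟩
  obtain ⟨u, hu⟩ := G.exists_succ v hv
  exact hd _ (eV u).2 ((h.edges v u).1 hu)

theorem preimage_side (h : c.Encodes eP eV G F) (p : P) :
    eV ⁻¹' c.side (eP p) true = {v | G.owner v = p} := by
  ext v
  simp [GameInput.side, List.getD, h.owner v, Fin.val_inj]

theorem preimage_aim (h : c.Encodes eP eV G F) (p : P) (I : Set V) :
    {S | eV.symm ⁻¹' S ∈ c.aim (eP p) (eV.symm ⁻¹' I) true} = improving F p I := by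
  obtain rfl := h.length_profiles
  have hF : ∀ j S, S ∈ F j p ↔ eV.symm ⁻¹' S ∈ c.families j (eP p) := by
    intro j S
    obtain ⟨prof, h1, fam, h2, h3⟩ := h.profiles j p
    rw [h3]
    simp only [GameInput.families, GameInput.family, List.getD, h1, h2, Option.getD_some,
      Set.mem_ofPred_eq, Set.mem_preimage, eV.symm.forall_congr_left, Equiv.symm_symm,
      Equiv.symm_apply_apply]
  ext S
  simp [GameInput.aim, improving, hF]

/-- The decision procedure is correct on inputs which describe an arena. -/
theorem hasEquilibrium_iff (h : c.Encodes eP eV G F) {T : List GameInput.Certificate}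
    (hT : c.IsComplete T) : c.HasEquilibrium T ↔
      ∃ σ : G.Profile, G.IsMultiNash σ fun j p => G.Muller (F j p) := by
  rw [GameInput.hasEquilibrium_iff]
  constructor
  · rintro ⟨I, -, π, h0, hR, hinf, hcert⟩
    have hstart : eV.symm (π 0) = G.init := by
      rw [Equiv.symm_apply_eq]
      exact Fin.ext (h0.trans h.init)
    have hreach : ∀ i, Relation.ReflTransGen G.E G.init (eV.symm (π i)) ∧
        G.E (eV.symm (π i)) (eV.symm (π (i + 1))) := by
      have hstep : ∀ i, Relation.ReflTransGen G.E G.init (eV.symm (π i)) →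
          G.E (eV.symm (π i)) (eV.symm (π (i + 1))) := fun i hi => by
        rw [← h.edge_iff _ hi]
        simpa using hR i
      intro i
      induction i with
      | zero => exact ⟨hstart ▸ .refl, hstep 0 (hstart ▸ .refl)⟩
      | succ i ih => exact ⟨ih.1.tail ih.2, hstep _ (ih.1.tail ih.2)⟩
    let ρ : G.Play := ⟨fun i => eV.symm (π i), hstart, fun i => (hreach i).2⟩
    have hI : bitSet c.numVertices I = eV.symm ⁻¹' G.Inf ρ := by
      rw [← hinf]
      change infSet π = eV.symm ⁻¹' infSet ρ.1
      rw [← infSet_comp_equiv]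
      simp [ρ]
    refine GameArena.exists_isMultiNash h.edge_iff ρ fun p i => ?_
    obtain ⟨t, -, ht, hcert⟩ := hcert i (eP p) (eP p).2
    have hf := hcert.forces
    rw [ht, GameInput.side_false, GameInput.aim_false, hI,
      show π i = eV (ρ.1 i) by simp [ρ]] at hf
    have := hf.of_equiv
    rw [← h.preimage_aim, show {v | G.owner v ≠ p} = (eV ⁻¹' c.side (eP p) true)ᶜ by
      rw [h.preimage_side]; rfl]
    exact this
  · rintro ⟨σ, hσ⟩
    obtain ⟨I, hI, hIeq⟩ := exists_bitSet_eq (eV.symm ⁻¹' G.Inf (G.out σ))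
    refine ⟨I, hI, fun i => eV ((G.out σ).1 i), ?_, ?_, ?_, ?_⟩
    · change (eV ((G.out σ).1 0)).val = c.init
      rw [(G.out σ).2.1, h.init]
    · intro i
      rw [h.edge_iff _ ((G.out σ).2.reachable i)]
      exact (G.out σ).2.2 i
    · rw [infSet_comp_equiv, hIeq]
      rfl
    · intro i p hp
      obtain ⟨p, rfl⟩ : ∃ q, (eP q).val = p := ⟨eP.symm ⟨p, hp⟩, by simp⟩
      obtain ⟨t, ht, hcert⟩ := hT (eP p) hp I hI (eV ((G.out σ).1 i)) (Fin.is_lt _)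
      refine ⟨t, ht, ?_, hcert⟩
      by_contra hb
      rw [Bool.not_eq_false] at hb
      have hf := hcert.forces
      rw [hb, hIeq] at hf
      have := hf.of_equiv
      rw [h.preimage_side, h.preimage_aim] at this
      exact hσ.not_forces h.edge_iff p i this

end GameInput.Encodes

/-- There is a decidable set `L` of inputs such that every input which describes a finite game
arena with objective profiles `α₁, …, αₙ` over Muller objectives lies in `L` if and only if there
is an `(α₁, …, αₙ)`-Nash equilibrium. -/
theorem theorem2 :
    ∃ L : GameInput → Prop, ComputablePred L ∧
      ∀ (P V : Type*) [Finite P] [Finite V] (G : GameArena P V) (n : ℕ)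
        (F : Fin n → P → Set (Set V)) (c : GameInput)
        (eP : P ≃ Fin c.numPlayers) (eV : V ≃ Fin c.numVertices),
        c.Encodes eP eV G F →
          (L c ↔ ∃ σ : G.Profile, G.IsMultiNash σ fun j p => G.Muller (F j p)) := by
  obtain ⟨T, hT, hcomplete⟩ := exists_computable_of_forall_exists
    GameInput.primrecRel_isComplete GameInput.exists_isComplete
  refine ⟨fun c => c.HasEquilibrium (T c),
    GameInput.primrecRel_hasEquilibrium.computablePred_comp hT, ?_⟩
  intro P V _ _ G n F c eP eV h
  exact h.hasEquilibrium_iff (hcomplete c)
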